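/- For a graph $G$ on $n$ vertices with adjacency matrix $A$, let $$f_\Delta(G)=\binom n3^{-1}\sum_{i<j<k}A_{ij}A_{jk}A_{ik},\qquad \widehat p(G)=\binom n2^{-1}\sum_{i<j}A_{ij},$$ $$\widehat\sigma(G)=\max\left\{2\sqrt{\frac{f_\Delta(G)\ln n}{\binom n3}},\ \sqrt{\frac{(3n\widehat p(G)+1)\,f_\Delta(G)\ln n}{\binom n3}}\right\}.$$ The proposed test, given graphs $G$ and $G'$, rejects the null hypothesis (that both come from the same model) if and only if $$T(G,G')=\frac{|f_\Delta(G)-f_\Delta(G')|}{2\widehat\sigma(G)+2\widehat\sigma(G')}>1$$ (with the convention $0/0=0$). Let $(p_n)_{n\ge1}\subset[0,1]$ satisfy $\frac{\ln n}{n}\le p_n\le\frac1{\sqrt n}$ for all $n\geq 1$, and let $(r_n)_{n\ge1}\subset\mathbb N$. For each $n$ let $Q_n^{\mathrm{ER}}$ be the Erdős–Rényi distribution on graphs with $n$ vertices and edge probability $p_n$, and let $Q_n^{\mathrm{Geom}}$ be the law of the following geometric random graph on $n$ vertices: draw $x_1,\dots,x_n$ independently and uniformly from the unit sphere of $\mathbb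 R^{r_n}$ and join $i\ne j$ if and only if $x_i^Tx_j\ge\tau_n$, where the threshold $\tau_n$ is such that $\mathbb P(x_1^Tx_2\ge\tau_n)=p_n$ for independent uniform points $x_1,x_2$ of the sphere (such a threshold is assumed to exist; it always does if $r_n\ge2$). If $r_n=o\big((\ln\frac1{p_n})^3\big)$ as $n\to\infty$, then the test is uniformly consistent for deciding whether two independent graphs on the same number of vertices, each drawn from one of these two models, come from the same model or from different models, that is, $$\lim_{n\to\infty}\ \sup_{m\ge n}\ \max_{Q\in\{Q_m^{\mathrm{ER}},Q_m^{\mathrm{Geom}}\}}\Big(\mathbb P_{G\sim Q,\,G'\sim Q}\big(T(G,G')>1\big)+\mathbb P_{G\sim Q,\,G'\sim \overline Q}\big(T(G,G')\le1\big)\Big)=0,$$ where $\overline Q$ denotes the other one of the two distributions. -/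

import Mathlib

open MeasureTheory Filter Topology
open scoped ENNReal

noncomputable section

/-- Entry `(i, j)` of the adjacency matrix of `G`, as a real number. -/
def adjEntry {n : ℕ} (G : SimpleGraph (Fin n)) (i j : Fin n) : ℝ :=
  open Classical in if G.Adj i j then 1 else 0

/-- The triangle statistic: the fraction of the `n choose 3` vertex triples that span a triangle. -/
def fTriangle {n : ℕ} (G : SimpleGraph (Fin n)) : ℝ :=
  (∑ i, ∑ j ∈ Finset.Ioi i, ∑ k ∈ Finset.Ioi j, adjEntry G i j * adjEntry G j k * adjEntry G i k) /
    (n.choose 3 : ℝ)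

/-- The estimated edge density: the fraction of the `n choose 2` vertex pairs that are edges. -/
def edgeDensity {n : ℕ} (G : SimpleGraph (Fin n)) : ℝ :=
  (∑ i, ∑ j ∈ Finset.Ioi i, adjEntry G i j) / (n.choose 2 : ℝ)

/-- Estimated deviation of the triangle statistic for sparse graphs with independent edges. -/
def sigmaHatER {n : ℕ} (G : SimpleGraph (Fin n)) : ℝ :=
  2 * √(fTriangle G * Real.log n / (n.choose 3 : ℝ))

/-- Estimated deviation of the triangle statistic for geometric graphs. -/
def sigmaHatGeom {n : ℕ} (G : SimpleGraph (Fin n)) : ℝ :=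
  √((3 * n * edgeDensity G + 1) * fTriangle G * Real.log n / (n.choose 3 : ℝ))

/-- Estimated deviation in the combined setting. -/
def sigmaHat {n : ℕ} (G : SimpleGraph (Fin n)) : ℝ :=
  max (sigmaHatER G) (sigmaHatGeom G)

/-- The two-sample test statistic. It only depends on the two observed graphs. -/
def testStat {n n' : ℕ} (G : SimpleGraph (Fin n)) (G' : SimpleGraph (Fin n')) : ℝ :=
  |fTriangle G - fTriangle G'| / (2 * sigmaHat G + 2 * sigmaHat G')

/-- The proposed test: reject the null hypothesis if and only if the test statistic exceeds `1`. -/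
def Rejects {n n' : ℕ} (G : SimpleGraph (Fin n)) (G' : SimpleGraph (Fin n')) : Prop :=
  1 < testStat G G'

/-- The unit sphere of `ℝ^r`. -/
abbrev UnitSphere (r : ℕ) : Type := Metric.sphere (0 : EuclideanSpace ℝ (Fin r)) 1

/-- The uniform distribution on the unit sphere of `ℝ^r`: normalised surface measure. -/
def uniformSphere (r : ℕ) : Measure (UnitSphere r) :=
  ((volume : Measure (EuclideanSpace ℝ (Fin r))).toSphere Set.univ)⁻¹ •
    (volume : Measure (EuclideanSpace ℝ (Fin r))).toSphere

/-- `τ` is a threshold for dimension `r` and edge probability `p`: two independent uniform points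
of the unit sphere have inner product at least `τ` with probability exactly `p`. -/
def IsThreshold (r : ℕ) (p τ : ℝ) : Prop :=
  (uniformSphere r).prod (uniformSphere r)
    {z | τ ≤ inner ℝ (z.1 : EuclideanSpace ℝ (Fin r)) (z.2 : EuclideanSpace ℝ (Fin r))} =
      ENNReal.ofReal p

/-- The geometric graph on given points: distinct `i, j` are adjacent when `⟨x i, x j⟩ ≥ τ`. -/
def geomGraph {n r : ℕ} (τ : ℝ) (x : Fin n → UnitSphere r) : SimpleGraph (Fin n) where
  Adj i j := i ≠ j ∧
    τ ≤ inner ℝ (x i : EuclideanSpace ℝ (Fin r)) (x j : EuclideanSpace ℝ (Fin r))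
  symm := ⟨fun i j h => ⟨h.1.symm, by rw [real_inner_comm]; exact h.2⟩⟩
  loopless := ⟨fun _ h => h.1 rfl⟩

theorem measurable_geomGraph {n r : ℕ} (τ : ℝ) :
    Measurable (geomGraph τ : (Fin n → UnitSphere r) → SimpleGraph (Fin n)) := by
  rw [SimpleGraph.measurable_iff_adj]
  intro i j
  have h : Continuous fun x : Fin n → UnitSphere r =>
      inner ℝ (x i : EuclideanSpace ℝ (Fin r)) (x j : EuclideanSpace ℝ (Fin r)) := by
    fun_prop
  exact (measurable_const : Measurable fun _ : Fin n → UnitSphere r => i ≠ j).and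
    (measurableSet_le measurable_const h.measurable).mem

/-- The law of the random geometric graph on `n` vertices in dimension `r` with threshold `τ`. -/
def geomLaw (n r : ℕ) (τ : ℝ) : Measure (SimpleGraph (Fin n)) :=
  (Measure.pi fun _ : Fin n => uniformSphere r).map (geomGraph τ)

/-- The two candidate models. -/
inductive Model : Type
  | ER
  | Geom

/-- The law on graphs with `n` vertices of each of the two models. -/
def modelLaw (n : ℕ) (p : unitInterval) (r : ℕ) (τ : ℝ) : Model → Measure (SimpleGraph (Fin n))
  | Model.ER => SimpleGraph.binomialRandom (Fin n) p
  | Model.Geom => geomLaw n r τ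

/-- Type-I error: the test rejects although both (independent) graphs are drawn from `Q`. -/
def typeIError {n : ℕ} (Q : Measure (SimpleGraph (Fin n))) : ℝ≥0∞ :=
  (Q.prod Q) {z | Rejects z.1 z.2}

/-- Type-II error: the test accepts although the (independent) graphs are drawn from `Q`, `Q'`. -/
def typeIIError {n : ℕ} (Q Q' : Measure (SimpleGraph (Fin n))) : ℝ≥0∞ :=
  (Q.prod Q') {z | ¬ Rejects z.1 z.2}

/-- Uniform consistency of the test for deciding whether two graphs on the same number of
vertices come from the same model of the family `Q`: the worst sum of the type-I and type-II errors
over all graph sizes `m ≥ n` vanishes as `n → ∞`. -/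
def UniformlyConsistent {ι : Type} (Q : (n : ℕ) → ι → Measure (SimpleGraph (Fin n))) : Prop :=
  Tendsto
    (fun n : ℕ => ⨆ m ≥ n, ⨆ i : ι,
      (typeIError (Q m i) + ⨆ j : ι, ⨆ _ : j ≠ i, typeIIError (Q m i) (Q m j)))
    atTop (𝓝 0)

end

/-!
# Consistency of the triangle test in low dimension

Write `p` for the edge probability and `q` for the probability that three given vertices of the
geometric graph span a triangle; under independent edges that probability is `p ^ 3`.

**Concentration.** In both models distinct edges are pairwise uncorrelated, and so are triangles with
at most one common vertex: for the geometric graph, rotation invariance makes the conditional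
probability of an edge, or of a triangle, given the position of one of its vertices constant, so
that all vertices outside the other edge or triangle can be integrated out
(`pi_edge_inter`, `pi_triangle_inter`). Two triangles with a common edge are both present with
probability at most `p q`. These facts (`CliqueMoments`) bound the variance of the triangle count by
its mean times `3 n p + 1`, which is what the estimated deviation imitates. Chebyshev's
inequality with `√(log n)` standard deviations therefore shows that the test accepts two graphs from
the same model, and rejects for `2 p ^ 3 ≤ q`, with probability `1 - O(1 / log n)`; here
`p ≥ log n / n` makes the mean count dominate the deviation (`mean_dominates`).

**Signal.** It remains to see `2 p ^ 3 ≤ q` (`two_mul_cube_le_triangleProb`). Let `K d τ` be the mass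
of the cap of height `τ` in dimension `d`, so that `p = K r τ`. Two points of the cap have inner
product at least `τ` as soon as their components orthogonal to the pole enclose an angle of cosine at
least `τ / (1 + τ)`, and these components have independent uniform directions in dimension `r - 1`.
Hence `q ≥ p ^ 2 * K (r - 1) (τ / (1 + τ))` (`capMass_sq_mul_capMass_le_triangleMass`).
If `r` is at most of order `log (1 / p)`, the crude bound
`K (r - 1) (τ / (1 + τ)) ≥ K (r - 1) (1 / 2) ≥ 4 ^ (1 - r)` suffices. Otherwise a linear map that
shrinks the ball along the pole shows that `K d (τ / (1 + τ))` exceeds `K d τ` by a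
factor exponential in `d τ ^ 3` (`mul_capMass_le_capMass`), and `K (r - 1) τ ≥ K r τ = p`
(`capMass_prod_le`). So only bounded `r τ ^ 3` could do harm; but then the cap is so low that
`log (1 / p)` is at most of order `r ^ (1 / 3)` (`log_le_of_low_cap`), against the growth
condition on the dimension.

Masses of caps are computed as relative volumes of cones in the unit ball, where slicing
by Fubini's theorem and linear changes of variables are available (`volume_norm_inter_cone`).
-/

noncomputable section

namespace TriangleTest

/-! ### Uniform directions and spherical caps -/

section Sphere

set_option linter.unusedSectionVars false

variable {E : Type*} [NormedAddCommGroup E] [InnerProductSpace ℝ E] [FiniteDimensional ℝ E]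
  [MeasurableSpace E] [BorelSpace E]
  {F : Type*} [NormedAddCommGroup F] [InnerProductSpace ℝ F] [FiniteDimensional ℝ F]
  [MeasurableSpace F] [BorelSpace F]

variable (E) in
/-- The uniform distribution on the unit sphere of a Euclidean space `E`. -/
def sphereLaw : Measure (Metric.sphere (0 : E) 1) :=
  ((volume : Measure E).toSphere Set.univ)⁻¹ • (volume : Measure E).toSphere

theorem uniformSphere_eq (r : ℕ) : uniformSphere r = sphereLaw (EuclideanSpace ℝ (Fin r)) := rfl

theorem toSphere_univ_ne_zero [Nontrivial E] : (volume : Measure E).toSphere Set.univ ≠ 0 := by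
  rw [Ne, Measure.measure_univ_eq_zero]
  exact Measure.toSphere_ne_zero _

instance [Nontrivial E] : IsProbabilityMeasure (sphereLaw E) :=
  ⟨by
    rw [sphereLaw, Measure.smul_apply, smul_eq_mul]
    exact ENNReal.inv_mul_cancel toSphere_univ_ne_zero (measure_ne_top _ _)⟩

/-- The direction `x / ‖x‖` of a vector, with an arbitrary value `e` at the origin. -/
def direction (e : Metric.sphere (0 : E) 1) (x : E) : Metric.sphere (0 : E) 1 :=
  open Classical in
  if h : x = 0 then e else ⟨‖x‖⁻¹ • x, by simp [norm_smul, h]⟩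

theorem coe_direction {x : E} (e : Metric.sphere (0 : E) 1) (hx : x ≠ 0) :
    (direction e x : E) = ‖x‖⁻¹ • x := by
  simp [direction, hx]

theorem measurable_direction (e : Metric.sphere (0 : E) 1) : Measurable (direction e) := by
  classical
  refine (MeasurableEmbedding.subtype_coe
    Metric.isClosed_sphere.measurableSet).measurable_comp_iff.1 ?_
  have h : (Subtype.val ∘ direction e : E → E) = fun x => if x = 0 then (e : E) else ‖x‖⁻¹ • x := by
    funext x
    by_cases hx : x = 0 <;> simp [direction, hx]
  rw [h]
  exact Measurable.ite (measurableSet_singleton 0) measurable_const (by fun_prop)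

/-- Polar coordinates: for a random vector that is uniform on a radially symmetric set, the
direction is uniform on the sphere. -/
theorem volume_norm_inter_direction [Nontrivial E] (e : Metric.sphere (0 : E) 1) {T : Set ℝ}
    (hT : MeasurableSet T) {S : Set (Metric.sphere (0 : E) 1)} (hS : MeasurableSet S) :
    volume {x : E | ‖x‖ ∈ T ∧ direction e x ∈ S} =
      volume {x : E | ‖x‖ ∈ T} * sphereLaw E S := by
  have key : ∀ S : Set (Metric.sphere (0 : E) 1), MeasurableSet S →
      volume {x : E | ‖x‖ ∈ T ∧ direction e x ∈ S} = (volume : Measure E).toSphere S *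
        Measure.volumeIoiPow (Module.finrank ℝ E - 1) {r | (r : ℝ) ∈ T} := by
    intro S hS
    have hT' : MeasurableSet {r : Set.Ioi (0 : ℝ) | (r : ℝ) ∈ T} := measurable_subtype_coe hT
    rw [← Measure.prod_prod,
      ← (Measure.measurePreserving_homeomorphUnitSphereProd (volume : Measure E)).measure_preimage
        (hS.prod hT').nullMeasurableSet,
      comap_subtype_coe_apply (measurableSet_singleton _).compl]
    rw [← measure_sdiff_null (measure_singleton (0 : E))]
    congr 1
    ext x
    simp only [Set.mem_sdiff, Set.mem_ofPred_eq, Set.mem_singleton_iff, Set.mem_image, Set.mem_preimage,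
      Set.mem_prod, Subtype.exists, Set.mem_compl_iff, exists_and_right, exists_eq_right]
    constructor
    · rintro ⟨⟨h1, h2⟩, h0⟩
      refine ⟨h0, ?_, by simpa using h1⟩
      convert h2 using 1
      ext
      simp [coe_direction e h0]
    · rintro ⟨h0, h1, h2⟩
      refine ⟨⟨by simpa using h2, ?_⟩, h0⟩
      convert h1 using 1
      ext
      simp [coe_direction e h0]
  have huniv := key Set.univ .univ
  simp only [Set.mem_univ, and_true] at huniv
  rw [key S hS, huniv, sphereLaw, Measure.smul_apply, smul_eq_mul]
  have h0 := toSphere_univ_ne_zero (E := E)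
  have h1 : (volume : Measure E).toSphere Set.univ ≠ ∞ := measure_ne_top _ _
  calc _ = ((volume : Measure E).toSphere Set.univ * ((volume : Measure E).toSphere Set.univ)⁻¹) *
        ((volume : Measure E).toSphere S *
          Measure.volumeIoiPow (Module.finrank ℝ E - 1) {r | (r : ℝ) ∈ T}) := by
        rw [ENNReal.mul_inv_cancel h0 h1, one_mul]
    _ = _ := by ring

theorem volume_ball_ne_zero : volume (Metric.ball (0 : E) 1) ≠ 0 :=
  (Metric.measure_ball_pos volume 0 one_pos).ne'

theorem volume_ball_ne_top : volume (Metric.ball (0 : E) 1) ≠ ∞ := measure_ball_lt_top.ne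

/-- The action of a linear isometry on unit vectors. -/
def sphereMap (φ : E ≃ₗᵢ[ℝ] F) (v : Metric.sphere (0 : E) 1) : Metric.sphere (0 : F) 1 :=
  ⟨φ v, by simp⟩

theorem measurePreserving_sphereMap [Nontrivial E] [Nontrivial F] (φ : E ≃ₗᵢ[ℝ] F) :
    MeasurePreserving (sphereMap φ) (sphereLaw E) (sphereLaw F) := by
  have hm : Measurable (sphereMap φ) :=
    (Continuous.subtype_mk (φ.continuous.comp continuous_subtype_val) _).measurable
  refine ⟨hm, ?_⟩
  ext S hS
  rw [Measure.map_apply hm hS]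
  obtain ⟨e⟩ : Nonempty (Metric.sphere (0 : E) 1) :=
    (NormedSpace.sphere_nonempty.2 zero_le_one).to_subtype
  have h1 := volume_norm_inter_direction e (measurableSet_Iio (a := (1 : ℝ))) (hm hS)
  have h2 := volume_norm_inter_direction (sphereMap φ e) (measurableSet_Iio (a := (1 : ℝ))) hS
  have hB : {x : E | ‖x‖ ∈ Set.Iio (1 : ℝ)} = φ ⁻¹' {x : F | ‖x‖ ∈ Set.Iio (1 : ℝ)} := by ext; simp
  have hA : {x : E | ‖x‖ ∈ Set.Iio (1 : ℝ) ∧ direction e x ∈ sphereMap φ ⁻¹' S} =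
      φ ⁻¹' {x : F | ‖x‖ ∈ Set.Iio (1 : ℝ) ∧ direction (sphereMap φ e) x ∈ S} := by
    ext x
    have : sphereMap φ (direction e x) = direction (sphereMap φ e) (φ x) := by
      by_cases hx : x = 0
      · simp [direction, hx]
      · ext
        simp [coe_direction, hx, sphereMap]
    simp [this]
  have hmeas : MeasurableSet {x : F | ‖x‖ ∈ Set.Iio (1 : ℝ)} :=
    measurable_norm measurableSet_Iio
  have hmeas' : MeasurableSet
      {x : F | ‖x‖ ∈ Set.Iio (1 : ℝ) ∧ direction (sphereMap φ e) x ∈ S} :=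
    hmeas.inter (measurable_direction _ hS)
  rw [hA, φ.measurePreserving.measure_preimage hmeas'.nullMeasurableSet, hB,
    φ.measurePreserving.measure_preimage hmeas.nullMeasurableSet, h2] at h1
  have hball : {x : F | ‖x‖ ∈ Set.Iio (1 : ℝ)} = Metric.ball 0 1 := by ext; simp
  rw [hball] at h1
  exact ((ENNReal.mul_right_inj volume_ball_ne_zero volume_ball_ne_top).1 h1).symm

/-- Two Euclidean spaces of the same dimension are identified by an isometry that matches two
given unit vectors. -/
theorem exists_isometry_apply_eq (h : Module.finrank ℝ E = Module.finrank ℝ F) {e : E} {f : F}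
    (he : ‖e‖ = 1) (hf : ‖f‖ = 1) : ∃ φ : E ≃ₗᵢ[ℝ] F, φ e = f := by
  let ψ : E ≃ₗᵢ[ℝ] F := (stdOrthonormalBasis ℝ E).equiv (stdOrthonormalBasis ℝ F) (finCongr h)
  exact ⟨ψ.trans (ℝ ∙ (ψ e - f))ᗮ.reflection, by
    simpa using Submodule.reflection_sub (v := ψ e) (w := f) (by simp [he, hf])⟩

/-- The mass of the spherical cap of height `τ` around the unit vector `e`. -/
def capMass (e : E) (τ : ℝ) : ℝ≥0∞ :=
  sphereLaw E {v | τ ≤ inner ℝ e (v : E)}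

/-- The probability that three independent uniform unit vectors, the first of which is fixed to be
`e`, have all pairwise inner products at least `τ`. -/
def triangleMass (e : E) (τ : ℝ) : ℝ≥0∞ :=
  (sphereLaw E).prod (sphereLaw E) {z | τ ≤ inner ℝ e (z.1 : E) ∧ τ ≤ inner ℝ e (z.2 : E) ∧
    τ ≤ inner ℝ (z.1 : E) (z.2 : E)}

theorem measurableSet_cap (e : E) (τ : ℝ) :
    MeasurableSet {v : Metric.sphere (0 : E) 1 | τ ≤ inner ℝ e (v : E)} :=
  measurableSet_le measurable_const (by fun_prop)

theorem measurableSet_triangle (e : E) (τ : ℝ) :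
    MeasurableSet {z : Metric.sphere (0 : E) 1 × Metric.sphere (0 : E) 1 |
      τ ≤ inner ℝ e (z.1 : E) ∧ τ ≤ inner ℝ e (z.2 : E) ∧ τ ≤ inner ℝ (z.1 : E) (z.2 : E)} := by
  rw [Set.ofPred_and, Set.ofPred_and]
  refine MeasurableSet.inter ?_ (MeasurableSet.inter ?_ ?_) <;>
  exact measurableSet_le measurable_const (by fun_prop)

theorem capMass_eq [Nontrivial E] [Nontrivial F] (h : Module.finrank ℝ E = Module.finrank ℝ F)
    {e : E} {f : F} (he : ‖e‖ = 1) (hf : ‖f‖ = 1) (τ : ℝ) : capMass e τ = capMass f τ := by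
  obtain ⟨φ, rfl⟩ := exists_isometry_apply_eq h he hf
  rw [capMass, capMass,
    ← (measurePreserving_sphereMap φ).measure_preimage (measurableSet_cap _ _).nullMeasurableSet]
  simp [sphereMap]

theorem triangleMass_eq [Nontrivial E] [Nontrivial F]
    (h : Module.finrank ℝ E = Module.finrank ℝ F) {e : E} {f : F} (he : ‖e‖ = 1) (hf : ‖f‖ = 1)
    (τ : ℝ) : triangleMass e τ = triangleMass f τ := by
  obtain ⟨φ, rfl⟩ := exists_isometry_apply_eq h he hf
  rw [triangleMass, triangleMass, ← ((measurePreserving_sphereMap φ).prod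
    (measurePreserving_sphereMap φ)).measure_preimage (measurableSet_triangle _ _).nullMeasurableSet]
  simp [sphereMap]

/-- The inner product of two independent uniform unit vectors is distributed like that of one of
them with a fixed unit vector. -/
theorem sphereLaw_prod_eq_capMass [Nontrivial E] {e : E} (he : ‖e‖ = 1) (τ : ℝ) :
    (sphereLaw E).prod (sphereLaw E) {z | τ ≤ inner ℝ (z.1 : E) (z.2 : E)} = capMass e τ := by
  rw [Measure.prod_apply (measurableSet_le measurable_const (by fun_prop))]
  have : ∀ v : Metric.sphere (0 : E) 1,
      sphereLaw E {a : Metric.sphere (0 : E) 1 | τ ≤ inner ℝ (v : E) (a : E)} = capMass e τ :=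
    fun v => capMass_eq rfl (norm_eq_of_mem_sphere v) he τ
  simp [this]

/-- The part of a radially symmetric set that lies in a cone around `f` has relative volume equal
to the mass of the corresponding spherical cap. -/
theorem volume_norm_inter_cone [Nontrivial E] {f : E} (hf : f ≠ 0) {e : E} (he : ‖e‖ = 1)
    {T : Set ℝ} (hT : MeasurableSet T) (τ : ℝ) :
    volume {x : E | ‖x‖ ∈ T ∧ τ * (‖f‖ * ‖x‖) ≤ inner ℝ f x} =
      volume {x : E | ‖x‖ ∈ T} * capMass e τ := by
  have hf' : 0 < ‖f‖ := norm_pos_iff.2 hf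
  have hu : ‖‖f‖⁻¹ • f‖ = 1 := by simp [norm_smul, hf]
  rw [capMass_eq rfl he hu, capMass,
    ← volume_norm_inter_direction ⟨e, by simpa using he⟩ hT (measurableSet_cap _ _),
    ← measure_sdiff_null (measure_singleton (0 : E)),
    ← measure_sdiff_null (s := {x : E | ‖x‖ ∈ T ∧ direction _ x ∈ _}) (measure_singleton (0 : E))]
  congr 1
  ext x
  simp only [Set.mem_sdiff, Set.mem_ofPred_eq, Set.mem_singleton_iff]
  refine and_congr_left fun hx => and_congr_right fun _ => ?_
  have hx' : 0 < ‖x‖ := norm_pos_iff.2 hx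
  rw [coe_direction _ hx, inner_smul_left, inner_smul_right, ← div_eq_inv_mul]
  simp only [conj_trivial]
  rw [← div_eq_inv_mul, le_div_iff₀ hf', le_div_iff₀ hx']
  ring_nf

theorem capMass_ne_top [Nontrivial E] (e : E) (τ : ℝ) : capMass e τ ≠ ∞ := measure_ne_top _ _

/-- A lower bound on the mass of the intersection of two caps with close poles gives a lower bound
on the triangle probability. -/
theorem capMass_mul_le_triangleMass [Nontrivial E] {e : E} {τ : ℝ} {c : ℝ≥0∞}
    (h : ∀ v : E, ‖v‖ = 1 → τ ≤ inner ℝ e v →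
      c ≤ sphereLaw E {w | τ ≤ inner ℝ e (w : E) ∧ τ ≤ inner ℝ v (w : E)}) :
    capMass e τ * c ≤ triangleMass e τ := by
  rw [triangleMass, Measure.prod_apply (measurableSet_triangle _ _), mul_comm, capMass,
    ← setLIntegral_const]
  refine (setLIntegral_mono' (measurableSet_cap _ _) fun v hv => ?_).trans
    (setLIntegral_le_lintegral _ _)
  refine (h v (norm_eq_of_mem_sphere v) hv).trans (measure_mono fun w hw => ?_)
  exact ⟨hv, hw⟩

end Sphere

/-! ### Slices of cones and the triangle probability -/

section Slices

set_option linter.unusedSectionVars false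

variable {F : Type*} [NormedAddCommGroup F] [InnerProductSpace ℝ F] [FiniteDimensional ℝ F]
  [MeasurableSpace F] [BorelSpace F]

theorem norm_toLp_prod (z : ℝ × F) : ‖WithLp.toLp 2 z‖ = √(z.1 ^ 2 + ‖z.2‖ ^ 2) := by
  rw [WithLp.prod_norm_eq_of_L2]
  simp

theorem inner_toLp_prod (z w : ℝ × F) :
    inner ℝ (WithLp.toLp 2 z) (WithLp.toLp 2 w) = z.1 * w.1 + inner ℝ z.2 w.2 := by
  rw [WithLp.prod_inner_apply]
  simp [mul_comm]

theorem volume_toLp_prod {P : WithLp 2 (ℝ × F) → Prop} (h : MeasurableSet {x | P x}) :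
    volume {x | P x} = ∫⁻ a : ℝ, volume {y : F | P (WithLp.toLp 2 (a, y))} := by
  have hm := WithLp.volume_preserving_toLp ℝ F
  rw [← hm.measure_preimage h.nullMeasurableSet, Measure.volume_eq_prod,
    Measure.prod_apply (hm.measurable h)]
  rfl

theorem capMass_mul_volume_ball {e : F} (he : ‖e‖ = 1) (τ : ℝ) :
    capMass e τ * volume (Metric.ball (0 : F) 1) =
      volume {x : F | ‖x‖ < 1 ∧ τ * ‖x‖ ≤ inner ℝ e x} := by
  have : Nontrivial F := ⟨e, 0, fun h => by simp [h] at he⟩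
  have h := volume_norm_inter_cone (f := e) (fun h => by simp [h] at he) he
    (measurableSet_Iio (a := (1 : ℝ))) τ
  have hB : {x : F | ‖x‖ ∈ Set.Iio (1 : ℝ)} = Metric.ball 0 1 := by ext; simp
  rw [hB] at h
  rw [mul_comm, ← h]
  simp [he]

theorem volume_ball_toLp_prod :
    volume (Metric.ball (0 : WithLp 2 (ℝ × F)) 1) =
      ∫⁻ a : ℝ, volume {y : F | ‖y‖ ∈ {t : ℝ | √(a ^ 2 + t ^ 2) < 1}} := by
  have : Metric.ball (0 : WithLp 2 (ℝ × F)) 1 = {x | ‖x‖ < 1} := by ext; simp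
  rw [this, volume_toLp_prod (measurableSet_lt measurable_norm measurable_const)]
  simp [norm_toLp_prod]

theorem measurableSet_cone (e : F) (τ : ℝ) :
    MeasurableSet {x : F | ‖x‖ < 1 ∧ τ * ‖x‖ ≤ inner ℝ e x} := by
  rw [Set.ofPred_and]
  exact (measurableSet_lt measurable_norm measurable_const).inter
    (measurableSet_le (by fun_prop) (by fun_prop))

/-- Caps of nonnegative height lose mass when the dimension grows: around a pole orthogonal to the
additional coordinate, each slice of the cone at a fixed value of that coordinate
lies in the cone of the smaller space. -/
theorem capMass_prod_le {e : WithLp 2 (ℝ × F)} (he : ‖e‖ = 1) {f : F} (hf : ‖f‖ = 1)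
    {τ : ℝ} (hτ : 0 ≤ τ) : capMass e τ ≤ capMass f τ := by
  have : Nontrivial F := ⟨f, 0, fun h => by simp [h] at hf⟩
  have : Nontrivial (WithLp 2 (ℝ × F)) := ⟨e, 0, fun h => by simp [h] at he⟩
  have he' : ‖WithLp.toLp 2 ((0 : ℝ), f)‖ = 1 := by simp [hf]
  rw [capMass_eq rfl he he']
  refine (ENNReal.mul_le_mul_iff_left (volume_ball_ne_zero (E := WithLp 2 (ℝ × F)))
    volume_ball_ne_top).1 ?_
  rw [capMass_mul_volume_ball he', volume_toLp_prod (measurableSet_cone _ _), volume_ball_toLp_prod,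
    ← lintegral_const_mul' _ _ (capMass_ne_top _ _)]
  refine lintegral_mono fun a => ?_
  have hT : MeasurableSet {t : ℝ | √(a ^ 2 + t ^ 2) < 1} :=
    measurableSet_lt (by fun_prop) measurable_const
  dsimp only
  rw [mul_comm, ← volume_norm_inter_cone (f := f) (fun h => by simp [h] at hf) hf hT]
  refine measure_mono fun y hy => ?_
  simp only [Set.mem_ofPred_eq, norm_toLp_prod, inner_toLp_prod, zero_mul, zero_add] at hy ⊢
  refine ⟨hy.1, le_trans ?_ hy.2⟩
  rw [hf, one_mul]
  gcongr
  exact Real.le_sqrt_of_sq_le (by nlinarith)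

/-- Spherical geometry behind the lower bound on the triangle probability, for unit vectors
`(a, y)`, `(b, z)` with `Y = ‖y‖`, `Z = ‖z‖`. -/
theorem le_inner_of_heights_unit {τ a b Y Z : ℝ} (h0 : 0 ≤ τ) (ha : a ^ 2 + Y ^ 2 = 1)
    (hb : b ^ 2 + Z ^ 2 = 1) (hY : 0 ≤ Y) (hZ : 0 ≤ Z) (haτ : τ ≤ a) (hbτ : τ ≤ b) :
    τ * (1 + τ) ≤ (1 + τ) * (a * b) + τ * (Y * Z) := by
  -- For `a ≤ b`, replacing `Y Z` by `Z ^ 2` and then `a` by `τ` leaves `τ (b - τ) (1 - b) ≥ 0`.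
  wlog hab : a ≤ b generalizing a b Y Z
  · have := this hb ha hZ hY hbτ haτ (le_of_not_ge hab)
    linarith [mul_comm a b, mul_comm Y Z]
  have hZY : Z ≤ Y := by
    nlinarith
  have hb1 : b ≤ 1 := by nlinarith
  have h1 : Z ^ 2 ≤ Y * Z := by nlinarith
  have h2 : 0 ≤ τ * ((b - τ) * (1 - b)) :=
    mul_nonneg h0 (mul_nonneg (by linarith) (by linarith))
  have h3 : τ * b * (1 + τ) ≤ a * b * (1 + τ) := by
    have : 0 ≤ b := h0.trans hbτ
    gcongr
  nlinarith [mul_le_mul_of_nonneg_left h1 h0]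

/-- If a unit vector `(a, y)` and a vector `(b, z)` both lie in the cone of height `τ` around the
first axis, then their inner product is at least `τ ‖(b, z)‖` as soon as `y` and `z` enclose an
angle of cosine at least `τ / (1 + τ)`. -/
theorem le_inner_of_heights {τ a b w : ℝ} {Y Z : ℝ} (h0 : 0 ≤ τ) (ha : a ^ 2 + Y ^ 2 = 1)
    (hY : 0 ≤ Y) (hZ : 0 ≤ Z) (haτ : τ ≤ a) (hbτ : τ * √(b ^ 2 + Z ^ 2) ≤ b)
    (hw : τ / (1 + τ) * (Y * Z) ≤ w) : τ * √(b ^ 2 + Z ^ 2) ≤ a * b + w := by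
  rcases (Real.sqrt_nonneg (b ^ 2 + Z ^ 2)).eq_or_lt with hN | hN
  · have hb0 : b = 0 := by
      have := Real.sqrt_eq_zero'.1 hN.symm
      nlinarith [sq_nonneg b, sq_nonneg Z]
    have : 0 ≤ τ / (1 + τ) * (Y * Z) := by positivity
    rw [← hN, hb0]
    linarith
  set N := √(b ^ 2 + Z ^ 2) with hNdef
  have hN2 : N ^ 2 = b ^ 2 + Z ^ 2 := Real.sq_sqrt (by positivity)
  have h := le_inner_of_heights_unit (b := b / N) (Z := Z / N) h0 ha
    (by field_simp; linarith) hY (by positivity) haτ (by rwa [le_div_iff₀ hN])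
  have h' : τ * N ≤ a * b + τ / (1 + τ) * (Y * Z) := by
    have h1 : 0 < 1 + τ := by linarith
    have e1 : (1 + τ) * (a * (b / N)) + τ * (Y * (Z / N)) =
      ((1 + τ) * (a * b) + τ * (Y * Z)) / N := by field_simp
    rw [e1, le_div_iff₀ hN] at h
    rw [← mul_le_mul_iff_right₀ h1]
    have e2 : (1 + τ) * (a * b + τ / (1 + τ) * (Y * Z)) = (1 + τ) * (a * b) + τ * (Y * Z) := by
      field_simp
    rw [e2]
    linarith
  linarith

/-- Two unit vectors of the cap of height `τ` have inner product at least `τ` as soon as their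
components orthogonal to the pole enclose an angle of cosine at least `τ / (1 + τ)`; these
components are uniformly directed, in one dimension less. -/
theorem capMass_mul_capMass_le {f : F} (hf : ‖f‖ = 1) {τ : ℝ} (h0 : 0 ≤ τ)
    {v : WithLp 2 (ℝ × F)} (hv : ‖v‖ = 1)
    (hvτ : τ ≤ inner ℝ (WithLp.toLp 2 ((1 : ℝ), (0 : F))) v) :
    capMass f (τ / (1 + τ)) * capMass (WithLp.toLp 2 ((1 : ℝ), (0 : F))) τ ≤
      sphereLaw (WithLp 2 (ℝ × F)) {w | τ ≤ inner ℝ (WithLp.toLp 2 ((1 : ℝ), (0 : F)))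
        (w : WithLp 2 (ℝ × F)) ∧ τ ≤ inner ℝ v (w : WithLp 2 (ℝ × F))} := by
  set e := WithLp.toLp 2 ((1 : ℝ), (0 : F)) with hedef
  have : Nontrivial F := ⟨f, 0, fun h => by simp [h] at hf⟩
  have : Nontrivial (WithLp 2 (ℝ × F)) := ⟨v, 0, fun h => by simp [h] at hv⟩
  have he : ‖e‖ = 1 := by simp [hedef]
  obtain ⟨⟨a, y⟩, rfl⟩ : ∃ z, WithLp.toLp 2 z = v := ⟨WithLp.ofLp v, rfl⟩
  have hS : MeasurableSet {w : Metric.sphere (0 : WithLp 2 (ℝ × F)) 1 |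
      τ ≤ inner ℝ e (w : WithLp 2 (ℝ × F)) ∧
        τ ≤ inner ℝ (WithLp.toLp 2 (a, y)) (w : WithLp 2 (ℝ × F))} := by
    rw [Set.ofPred_and]
    exact (measurableSet_cap _ _).inter (measurableSet_cap _ _)
  have hpolar := volume_norm_inter_direction ⟨e, by simpa using he⟩
    (measurableSet_Iio (a := (1 : ℝ))) hS
  have hB : {x : WithLp 2 (ℝ × F) | ‖x‖ ∈ Set.Iio (1 : ℝ)} = Metric.ball 0 1 := by ext; simp
  rw [hB, mul_comm] at hpolar
  refine (ENNReal.mul_le_mul_iff_left (volume_ball_ne_zero (E := WithLp 2 (ℝ × F)))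
    volume_ball_ne_top).1 ?_
  refine le_of_le_of_eq ?_ hpolar
  rw [mul_assoc, capMass_mul_volume_ball he]
  have hsub : volume {x : WithLp 2 (ℝ × F) | (‖x‖ < 1 ∧ τ * ‖x‖ ≤ inner ℝ e x) ∧
        τ / (1 + τ) * (‖y‖ * ‖(WithLp.ofLp x).2‖) ≤ inner ℝ y (WithLp.ofLp x).2} ≤
      volume {x : WithLp 2 (ℝ × F) | ‖x‖ ∈ Set.Iio (1 : ℝ) ∧ direction ⟨e, by simpa using he⟩ x ∈
        {w : Metric.sphere (0 : WithLp 2 (ℝ × F)) 1 | τ ≤ inner ℝ e (w : WithLp 2 (ℝ × F)) ∧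
          τ ≤ inner ℝ (WithLp.toLp 2 (a, y)) (w : WithLp 2 (ℝ × F))}} := by
    -- The direction of the origin is a junk value.
    rw [← measure_sdiff_null (measure_singleton (0 : WithLp 2 (ℝ × F)))]
    refine measure_mono ?_
    rintro x ⟨⟨⟨hx1, hx2⟩, hx3⟩, hx0⟩
    have hx0' : x ≠ 0 := hx0
    have hxpos : 0 < ‖x‖ := norm_pos_iff.2 hx0'
    have hkey : τ * ‖x‖ ≤ inner ℝ (WithLp.toLp 2 (a, y)) x := by
      obtain ⟨⟨b, z⟩, rfl⟩ : ∃ z, WithLp.toLp 2 z = x := ⟨WithLp.ofLp x, rfl⟩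
      rw [hedef] at hvτ hx2
      simp only [norm_toLp_prod, inner_toLp_prod, one_mul, inner_zero_left, add_zero] at *
      refine le_inner_of_heights h0 ?_ (norm_nonneg y) (norm_nonneg z) hvτ hx2 hx3
      have := congrArg (· ^ 2) hv
      simpa [Real.sq_sqrt (by positivity : 0 ≤ a ^ 2 + ‖y‖ ^ 2)] using this
    refine ⟨by simpa using hx1, ?_⟩
    simp only [Set.mem_ofPred_eq, coe_direction _ hx0', inner_smul_right]
    rw [← div_eq_inv_mul, ← div_eq_inv_mul, le_div_iff₀ hxpos, le_div_iff₀ hxpos]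
    exact ⟨hx2, hkey⟩
  refine le_trans ?_ hsub
  have hmeas : MeasurableSet {x : WithLp 2 (ℝ × F) | (‖x‖ < 1 ∧ τ * ‖x‖ ≤ inner ℝ e x) ∧
        τ / (1 + τ) * (‖y‖ * ‖(WithLp.ofLp x).2‖) ≤ inner ℝ y (WithLp.ofLp x).2} := by
    rw [Set.ofPred_and]
    have : Measurable fun x : WithLp 2 (ℝ × F) => (WithLp.ofLp x).2 :=
      measurable_snd.comp (WithLp.volume_preserving_ofLp ℝ F).measurable
    exact (measurableSet_cone _ _).inter (measurableSet_le (by fun_prop) (by fun_prop))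
  rw [volume_toLp_prod hmeas, volume_toLp_prod (measurableSet_cone _ _),
    ← lintegral_const_mul' _ _ (capMass_ne_top _ _)]
  -- For each first coordinate `b`, the condition on the second component is an angle condition on a
  -- radially symmetric set.
  refine lintegral_mono fun b => ?_
  simp only [norm_toLp_prod, inner_toLp_prod, hedef, one_mul, inner_zero_left, add_zero]
  have hT : MeasurableSet {t : ℝ | √(b ^ 2 + t ^ 2) < 1 ∧ τ * √(b ^ 2 + t ^ 2) ≤ b} := by
    rw [Set.ofPred_and]
    exact (measurableSet_lt (by fun_prop) measurable_const).inter
      (measurableSet_le (by fun_prop) measurable_const)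
  by_cases hy : y = 0
  · simp only [hy, norm_zero, zero_mul, mul_zero, inner_zero_left, le_refl, and_true]
    exact mul_le_of_le_one_left' prob_le_one
  · have h := volume_norm_inter_cone hy hf hT (τ / (1 + τ))
    simp only [Set.mem_ofPred_eq] at h
    rw [h, mul_comm]

/-- The lower bound `q ≥ p ^ 2 * K` on the triangle probability, with `K` the mass of the cap of
height `τ / (1 + τ)` in one dimension less. -/
theorem capMass_sq_mul_capMass_le_triangleMass {f : F} (hf : ‖f‖ = 1) {e : WithLp 2 (ℝ × F)}
    (he : ‖e‖ = 1) {τ : ℝ} (h0 : 0 ≤ τ) :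
    capMass e τ ^ 2 * capMass f (τ / (1 + τ)) ≤ triangleMass e τ := by
  have : Nontrivial F := ⟨f, 0, fun h => by simp [h] at hf⟩
  have : Nontrivial (WithLp 2 (ℝ × F)) := ⟨e, 0, fun h => by simp [h] at he⟩
  have he' : ‖WithLp.toLp 2 ((1 : ℝ), (0 : F))‖ = 1 := by simp
  rw [capMass_eq rfl he he', triangleMass_eq rfl he he', sq, mul_assoc,
    mul_comm _ (capMass f _)]
  exact capMass_mul_le_triangleMass fun v hv hvτ => capMass_mul_capMass_le hf h0 hv hvτ

end Slices

/-! ### Caps and linear changes of variables -/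

section Stretch

set_option linter.unusedSectionVars false

variable {E : Type*} [NormedAddCommGroup E] [InnerProductSpace ℝ E] [FiniteDimensional ℝ E]
  [MeasurableSpace E] [BorelSpace E]

theorem nontrivial_of_norm_eq_one {e : E} (he : ‖e‖ = 1) : Nontrivial E :=
  ⟨e, 0, fun h => by simp [h] at he⟩

/-- For a unit vector `e`, the linear map that scales the line of `e` by `c` and its orthogonal
complement by `ρ`. -/
def stretch (e : E) (c ρ : ℝ) : E →ₗ[ℝ] E :=
  ρ • LinearMap.transvection ((c / ρ - 1) • (innerₛₗ ℝ e)) e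

theorem stretch_apply (e x : E) (c : ℝ) {ρ : ℝ} (hρ : ρ ≠ 0) :
    stretch e c ρ x = ρ • x + ((c - ρ) * inner ℝ e x) • e := by
  have : ρ * ((c / ρ - 1) * inner ℝ e x) = (c - ρ) * inner ℝ e x := by field_simp
  simp [stretch, LinearMap.transvection.apply, smul_smul, this]

theorem inner_stretch {e : E} (he : ‖e‖ = 1) (x : E) (c : ℝ) {ρ : ℝ} (hρ : ρ ≠ 0) :
    inner ℝ e (stretch e c ρ x) = c * inner ℝ e x := by
  rw [stretch_apply e x c hρ, inner_add_right, inner_smul_right, inner_smul_right,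
    real_inner_self_eq_norm_sq, he]
  ring

theorem norm_sq_add_stretch {e : E} (he : ‖e‖ = 1) (x : E) (b c : ℝ) {ρ : ℝ} (hρ : ρ ≠ 0) :
    ‖b • e + stretch e c ρ x‖ ^ 2 =
      (b + c * inner ℝ e x) ^ 2 + ρ ^ 2 * (‖x‖ ^ 2 - inner ℝ e x ^ 2) := by
  have : b • e + stretch e c ρ x = ρ • x + (b + (c - ρ) * inner ℝ e x) • e := by
    rw [stretch_apply e x c hρ, add_smul]
    abel
  rw [this, norm_add_sq_real, inner_smul_left, inner_smul_right, norm_smul, norm_smul, he,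
    real_inner_comm]
  simp only [conj_trivial, mul_pow, Real.norm_eq_abs, sq_abs]
  ring

theorem det_stretch {e : E} (he : ‖e‖ = 1) (c : ℝ) {ρ : ℝ} (hρ : ρ ≠ 0) :
    LinearMap.det (stretch e c ρ) = c * ρ ^ (Module.finrank ℝ E - 1) := by
  have := nontrivial_of_norm_eq_one he
  have hpos : 0 < Module.finrank ℝ E := Module.finrank_pos
  obtain ⟨k, hk⟩ := Nat.exists_eq_add_of_lt hpos
  rw [stretch, LinearMap.det_smul, LinearMap.transvection.det, hk]
  simp [he]
  field_simp
  ring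

/-- An affine map from `A` into `B` bounds the volume of `B` from below. -/
theorem det_mul_volume_le {A B : Set E} (w : E) (L : E →ₗ[ℝ] E)
    (h : ∀ x ∈ A, w + L x ∈ B) : ENNReal.ofReal |LinearMap.det L| * volume A ≤ volume B := by
  rw [← Measure.addHaar_image_linearMap, ← measure_preimage_add volume (-w)]
  refine measure_mono fun y hy => ?_
  obtain ⟨x, hx, hxy⟩ := hy
  have := h x hx
  rw [hxy] at this
  simpa using this

theorem capMass_anti (e : E) {σ τ : ℝ} (h : σ ≤ τ) : capMass e τ ≤ capMass e σ :=
  measure_mono fun _ hv => h.trans hv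

theorem capMass_eq_zero {e : E} (he : ‖e‖ = 1) {τ : ℝ} (h : 1 < τ) : capMass e τ = 0 := by
  have : {v : Metric.sphere (0 : E) 1 | τ ≤ inner ℝ e (v : E)} = ∅ := by
    refine Set.eq_empty_of_forall_notMem fun v hv => ?_
    have h1 := real_inner_le_norm e (v : E)
    rw [he, norm_eq_of_mem_sphere, one_mul] at h1
    exact absurd (h.trans_le hv) (not_lt.2 h1)
  rw [capMass, this, measure_empty]

theorem half_le_capMass {e : E} (he : ‖e‖ = 1) {τ : ℝ} (h : τ ≤ 0) : 1 / 2 ≤ capMass e τ := by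
  have := nontrivial_of_norm_eq_one he
  refine le_trans ?_ (capMass_anti e h)
  have h1 : (1 : ℝ≥0∞) ≤ capMass e 0 + capMass (-e) 0 := by
    rw [← measure_univ (μ := sphereLaw E), capMass, capMass]
    refine (measure_mono fun v _ => ?_).trans (measure_union_le _ _)
    simp only [inner_neg_left, Left.nonneg_neg_iff, Set.mem_union, Set.mem_ofPred_eq]
    exact le_total _ _
  rw [capMass_eq rfl (by simpa using he) he (e := -e), ← two_mul] at h1
  rw [ENNReal.div_le_iff_le_mul (by simp) (by simp), mul_comm]
  exact h1

/-- A lower bound on the mass of a low cap: an affine image of the unit ball fits into its cone. -/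
theorem mul_pow_le_capMass {e : E} (he : ‖e‖ = 1) {τ c ρ : ℝ} (hτ : τ ≤ c) (hc : 0 < c)
    (hρ : 0 < ρ) (hρc : ρ ^ 2 = 1 - 9 * c ^ 2) :
    ENNReal.ofReal (c * ρ ^ (Module.finrank ℝ E - 1)) ≤ capMass e τ := by
  refine le_trans ?_ (capMass_anti e hτ)
  -- The image of the ball has coordinates between `c` and `3 c` along the pole.
  have h := det_mul_volume_le (A := Metric.ball (0 : E) 1)
    (B := {x : E | ‖x‖ < 1 ∧ c * ‖x‖ ≤ inner ℝ e x}) ((2 * c) • e) (stretch e c ρ) ?_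
  · rw [det_stretch he c hρ.ne', ← capMass_mul_volume_ball he, abs_of_pos (by positivity)] at h
    exact (ENNReal.mul_le_mul_iff_left volume_ball_ne_zero volume_ball_ne_top).1 h
  intro x hx
  have hx1 : ‖x‖ < 1 := by simpa using hx
  have ha := abs_real_inner_le_norm e x
  rw [he, one_mul] at ha
  have ha' := abs_le.1 ha
  set a := inner ℝ e x with hadef
  have hn : ‖(2 * c) • e + stretch e c ρ x‖ < 1 := by
    rw [← sq_lt_one_iff₀ (norm_nonneg _), norm_sq_add_stretch he x _ c hρ.ne', ← hadef]
    have h1 : (2 * c + c * a) ^ 2 < (3 * c) ^ 2 := by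
      apply sq_lt_sq'
      · nlinarith
      · nlinarith
    have h2 : ‖x‖ ^ 2 - a ^ 2 ≤ 1 := by nlinarith [norm_nonneg x]
    nlinarith [mul_le_mul_of_nonneg_left h2 (sq_nonneg ρ)]
  refine ⟨hn, ?_⟩
  rw [inner_add_right, inner_smul_right, real_inner_self_eq_norm_sq, he, inner_stretch he x c hρ.ne',
    ← hadef]
  nlinarith [norm_nonneg ((2 * c) • e + stretch e c ρ x)]

/-- A cap of height `1 / 2` is not too small: its cone contains a ball of radius `1 / 4`. -/
theorem pow_le_capMass_half {e : E} (he : ‖e‖ = 1) :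
    ENNReal.ofReal ((1 / 4) ^ Module.finrank ℝ E) ≤ capMass e (1 / 2) := by
  have h := det_mul_volume_le (A := Metric.ball (0 : E) 1)
    (B := {x : E | ‖x‖ < 1 ∧ 1 / 2 * ‖x‖ ≤ inner ℝ e x}) ((3 / 4 : ℝ) • e)
    ((1 / 4 : ℝ) • LinearMap.id) ?_
  · rw [LinearMap.det_smul, LinearMap.det_id, mul_one, ← capMass_mul_volume_ball he,
      abs_of_pos (by positivity)] at h
    exact (ENNReal.mul_le_mul_iff_left volume_ball_ne_zero volume_ball_ne_top).1 h
  intro x hx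
  have hx1 : ‖x‖ < 1 := by simpa using hx
  have ha := abs_real_inner_le_norm e x
  rw [he, one_mul] at ha
  have ha' := abs_le.1 ha
  simp only [LinearMap.smul_apply, LinearMap.id_apply]
  have hn : ‖(3 / 4 : ℝ) • e + (1 / 4 : ℝ) • x‖ < 1 := by
    refine (norm_add_le _ _).trans_lt ?_
    rw [norm_smul, norm_smul, he]
    norm_num
    linarith
  refine ⟨hn, ?_⟩
  rw [inner_add_right, inner_smul_right, inner_smul_right, real_inner_self_eq_norm_sq, he]
  linarith

/-- Lowering the height of a cap from `τ` to `τ / (1 + τ)` increases its mass by a factor that is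
exponential in `finrank E * τ ^ 3`: the stretch by `κ β` along the pole and by `β` orthogonally to
it, with `κ ^ 2 = 1 - τ / 2` and `β ^ 2 = 1 / (1 - τ ^ 3 / 2)`, maps the part of the
higher cone in the unit ball into that of the lower one. -/
theorem mul_capMass_le_capMass {e : E} (he : ‖e‖ = 1) {τ κ β : ℝ} (h0 : 0 < τ)
    (hκ : 0 < κ) (hβ : 0 < β) (hκ2 : κ ^ 2 = 1 - τ / 2) (hβ2 : β ^ 2 * (1 - τ ^ 3 / 2) = 1) :
    ENNReal.ofReal (κ * β ^ Module.finrank ℝ E) * capMass e τ ≤ capMass e (τ / (1 + τ)) := by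
  have := nontrivial_of_norm_eq_one he
  have h := det_mul_volume_le (A := {x : E | ‖x‖ < 1 ∧ τ * ‖x‖ ≤ inner ℝ e x})
    (B := {x : E | ‖x‖ < 1 ∧ τ / (1 + τ) * ‖x‖ ≤ inner ℝ e x}) ((0 : ℝ) • e)
    (stretch e (κ * β) β) ?_
  · have hd : |κ * β * β ^ (Module.finrank ℝ E - 1)| = κ * β ^ Module.finrank ℝ E := by
      rw [abs_of_pos (by positivity), mul_assoc, ← pow_succ',
        Nat.sub_add_cancel Module.finrank_pos]
    rw [det_stretch he _ hβ.ne', hd, ← capMass_mul_volume_ball he,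
      ← capMass_mul_volume_ball he, ← mul_assoc] at h
    exact (ENNReal.mul_le_mul_iff_left volume_ball_ne_zero volume_ball_ne_top).1 h
  rintro x ⟨hx1, hx2⟩
  have hnorm := norm_sq_add_stretch he x 0 (κ * β) hβ.ne'
  set z := (0 : ℝ) • e + stretch e (κ * β) β x with hz
  set a := inner ℝ e x with hadef
  have ha0 : 0 ≤ a := (by positivity : 0 ≤ τ * ‖x‖).trans hx2
  have hsq : τ ^ 2 * ‖x‖ ^ 2 ≤ a ^ 2 := by
    have := pow_le_pow_left₀ (by positivity) hx2 2
    linarith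
  have hnorm' : ‖z‖ ^ 2 = β ^ 2 * (‖x‖ ^ 2 - τ / 2 * a ^ 2) := by
    rw [hnorm, zero_add, mul_pow, mul_pow, hκ2]
    ring
  have hle : ‖z‖ ^ 2 ≤ ‖x‖ ^ 2 := by
    calc ‖z‖ ^ 2 ≤ β ^ 2 * (‖x‖ ^ 2 - τ / 2 * (τ ^ 2 * ‖x‖ ^ 2)) := by rw [hnorm']; gcongr
      _ = (β ^ 2 * (1 - τ ^ 3 / 2)) * ‖x‖ ^ 2 := by ring
      _ = ‖x‖ ^ 2 := by rw [hβ2, one_mul]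
  have hn : ‖z‖ < 1 := ((pow_le_pow_iff_left₀ (norm_nonneg _) (norm_nonneg _) two_ne_zero).1
    hle).trans_lt hx1
  refine ⟨hn, ?_⟩
  have hin : inner ℝ e z = κ * β * a := by
    rw [hz, zero_smul, zero_add, inner_stretch he _ _ hβ.ne']
  rw [hin]
  refine (pow_le_pow_iff_left₀ (by positivity) (by positivity) two_ne_zero).1 ?_
  rw [mul_pow, hnorm', div_pow, div_mul_eq_mul_div, div_le_iff₀ (by positivity), mul_pow, mul_pow,
    hκ2]
  have hkey : τ ^ 2 * (‖x‖ ^ 2 - τ / 2 * a ^ 2) ≤ (1 - τ / 2) * a ^ 2 * (1 + τ) ^ 2 := by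
    have : 0 ≤ a ^ 2 * (3 / 2 * τ) := by positivity
    nlinarith [mul_nonneg (sq_nonneg a) (sq_nonneg τ), mul_nonneg (sq_nonneg a) h0.le]
  nlinarith [mul_le_mul_of_nonneg_left hkey (sq_nonneg β)]

/-- The case of a factor `2` in `mul_capMass_le_capMass`. -/
theorem two_mul_capMass_le_capMass {e : E} (he : ‖e‖ = 1) {τ : ℝ} (h0 : 0 < τ) (h1 : τ ≤ 1)
    (h : 14 ≤ Module.finrank ℝ E * τ ^ 3) : 2 * capMass e τ ≤ capMass e (τ / (1 + τ)) := by
  have h3 : τ ^ 3 ≤ 1 := pow_le_one₀ h0.le h1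
  have hd : 0 < 1 - τ ^ 3 / 2 := by linarith
  refine le_trans ?_ (mul_capMass_le_capMass he h0 (κ := √(1 - τ / 2))
    (β := √(1 - τ ^ 3 / 2)⁻¹) (Real.sqrt_pos.2 (by linarith)) (Real.sqrt_pos.2 (by positivity))
    (Real.sq_sqrt (by linarith)) ?_)
  · gcongr
    rw [← ENNReal.ofReal_ofNat]
    refine ENNReal.ofReal_le_ofReal ?_
    -- The square of the factor is at least `(1 / 2) * (1 + m τ ^ 3 / 2) ≥ 4` in dimension `m`.
    refine (pow_le_pow_iff_left₀ (by norm_num) (by positivity) two_ne_zero).1 ?_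
    rw [mul_pow, ← pow_mul, mul_comm _ 2, pow_mul, Real.sq_sqrt (by linarith),
      Real.sq_sqrt (by positivity)]
    have hb : 1 + Module.finrank ℝ E * (τ ^ 3 / 2) ≤ ((1 - τ ^ 3 / 2)⁻¹) ^ Module.finrank ℝ E := by
      refine (one_add_mul_le_pow (by linarith [pow_pos h0 3]) _).trans ?_
      gcongr
      rw [← one_div, le_div_iff₀ hd]
      nlinarith [pow_pos h0 3]
    nlinarith
  · rw [Real.sq_sqrt (by positivity)]
    exact inv_mul_cancel₀ hd.ne'

end Stretch

/-! ### The triangle signal in low dimension -/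

section Signal

set_option linter.unusedSectionVars false

variable {F : Type*} [NormedAddCommGroup F] [InnerProductSpace ℝ F] [FiniteDimensional ℝ F]
  [MeasurableSpace F] [BorelSpace F]

theorem finrank_toLp_prod : Module.finrank ℝ (WithLp 2 (ℝ × F)) = Module.finrank ℝ F + 1 := by
  rw [(WithLp.linearEquiv 2 ℝ (ℝ × F)).finrank_eq, Module.finrank_prod, Module.finrank_self,
    add_comm]

theorem exp_neg_two_mul_le {u : ℝ} (h0 : 0 ≤ u) (h : u ≤ 1 / 2) : Real.exp (-(2 * u)) ≤ 1 - u := by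
  rw [Real.exp_neg, inv_le_comm₀ (Real.exp_pos _) (by linarith)]
  refine le_trans ?_ (Real.add_one_le_exp _)
  rw [inv_le_iff_one_le_mul₀ (by linarith)]
  nlinarith

/-- If a cap has height at most `x` in dimension `m + 1`, where `m x ^ 3 = 14`, then
the reciprocal of its mass is only exponential in the cube root of the dimension. -/
theorem log_le_of_low_cap {E : Type*} [NormedAddCommGroup E] [InnerProductSpace ℝ E]
    [FiniteDimensional ℝ E] [MeasurableSpace E] [BorelSpace E] {e : E} (he : ‖e‖ = 1) {m : ℕ}
    (hm : Module.finrank ℝ E = m + 1) {x τ p : ℝ} (hx : 0 < x) (hx' : x ≤ 1 / 5)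
    (hxm : m * x ^ 3 = 14) (hτ : τ ≤ x) (hp : 0 < p) (hcap : capMass e τ = ENNReal.ofReal p) :
    Real.log (1 / p) ≤ 127 / x := by
  have hpos : 0 < 1 - 9 * x ^ 2 := by nlinarith
  have h := mul_pow_le_capMass he hτ hx (Real.sqrt_pos.2 hpos) (Real.sq_sqrt hpos.le)
  rw [hcap, hm, Nat.add_sub_cancel, ENNReal.ofReal_le_ofReal_iff hp.le] at h
  have hs : Real.exp (-(9 * x ^ 2)) ≤ √(1 - 9 * x ^ 2) := by
    refine Real.le_sqrt_of_sq_le ?_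
    rw [← Real.exp_nat_mul]
    refine le_trans (le_of_eq ?_) (exp_neg_two_mul_le (u := 9 * x ^ 2) (by positivity) (by nlinarith))
    push_cast
    ring_nf
  have h2 : Real.exp (-(126 / x)) ≤ √(1 - 9 * x ^ 2) ^ m := by
    refine le_trans (le_of_eq ?_) (pow_le_pow_left₀ (Real.exp_pos _).le hs m)
    rw [← Real.exp_nat_mul]
    congr 1
    field_simp
    linear_combination 9 * hxm
  have h3 : Real.exp (-(1 / x)) ≤ x := by
    rw [Real.exp_neg, inv_le_comm₀ (Real.exp_pos _) hx, ← one_div]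
    linarith [Real.add_one_le_exp (1 / x)]
  have h4 : Real.exp (-(127 / x)) ≤ p := by
    calc Real.exp (-(127 / x)) = Real.exp (-(1 / x)) * Real.exp (-(126 / x)) := by
          rw [← Real.exp_add]
          congr 1
          ring
      _ ≤ x * √(1 - 9 * x ^ 2) ^ m := by gcongr
      _ ≤ p := h
  rw [one_div, Real.log_inv, neg_le, Real.le_log_iff_exp_le hp]
  exact h4

/-- In dimension `o(log(1 / p) ^ 3)` the triangle probability of the geometric model is at least
twice that of independent edges. -/
theorem two_mul_cube_le_triangleMass {f : F} (hf : ‖f‖ = 1) {e : WithLp 2 (ℝ × F)}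
    (he : ‖e‖ = 1) {τ p : ℝ} (hp : 0 < p) (hcap : capMass e τ = ENNReal.ofReal p)
    (hL : 4000 ≤ Real.log (1 / p))
    (hdim : (Module.finrank ℝ F + 1) * (127 : ℝ) ^ 3 ≤ Real.log (1 / p) ^ 3) :
    ENNReal.ofReal (2 * p ^ 3) ≤ triangleMass e τ := by
  have := nontrivial_of_norm_eq_one hf
  have := nontrivial_of_norm_eq_one he
  set m := Module.finrank ℝ F with hmdef
  set L := Real.log (1 / p) with hLdef
  have hpL : p = Real.exp (-L) := by
    rw [hLdef, one_div, Real.log_inv, neg_neg, Real.exp_log hp]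
  have hp2 : p < 1 / 2 := by
    have h1 := Real.add_one_le_exp L
    rw [hpL, Real.exp_neg, inv_lt_comm₀ (Real.exp_pos _) (by norm_num)]
    norm_num
    linarith
  have hτ0 : 0 < τ := by
    by_contra hτ
    have h := half_le_capMass he (not_lt.1 hτ)
    rw [hcap, show (1 / 2 : ℝ≥0∞) = ENNReal.ofReal (1 / 2) by
      rw [ENNReal.ofReal_div_of_pos (by norm_num)]; simp,
      ENNReal.ofReal_le_ofReal_iff hp.le] at h
    linarith
  have hτ1 : τ ≤ 1 := by
    by_contra hτ
    have h := capMass_eq_zero he (not_le.1 hτ)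
    rw [hcap, ENNReal.ofReal_eq_zero] at h
    linarith
  suffices hs : ENNReal.ofReal (2 * p) ≤ capMass f (τ / (1 + τ)) by
    refine le_trans ?_ (capMass_sq_mul_capMass_le_triangleMass hf he hτ0.le)
    rw [hcap, ← ENNReal.ofReal_pow hp.le, show 2 * p ^ 3 = p ^ 2 * (2 * p) by ring,
      ENNReal.ofReal_mul (by positivity)]
    gcongr
  -- In small dimension, even caps of height `1 / 2` have mass at least `2 p`.
  rcases le_total (2 * m + 2 : ℝ) L with hcase | hcase
  · refine le_trans ?_ ((pow_le_capMass_half hf).trans (capMass_anti f ?_))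
    · refine ENNReal.ofReal_le_ofReal ?_
      have h1 : p ≤ Real.exp (-2) ^ m * Real.exp (-2) := by
        rw [hpL, ← Real.exp_nat_mul, ← Real.exp_add]
        refine Real.exp_le_exp.2 ?_
        linarith
      have h2 : Real.exp (-2) ≤ 1 / 4 := by
        rw [Real.exp_neg, inv_le_comm₀ (Real.exp_pos _) (by norm_num)]
        have : Real.exp 2 = Real.exp 1 ^ 2 := by rw [← Real.exp_nat_mul]; norm_num
        rw [this]
        nlinarith [Real.add_one_le_exp 1]
      calc 2 * p ≤ 2 * ((1 / 4) ^ m * (1 / 4)) := by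
            refine mul_le_mul_of_nonneg_left (h1.trans ?_) (by norm_num)
            gcongr
        _ ≤ (1 / 4) ^ m := by
            have : (0 : ℝ) < (1 / 4) ^ m := by positivity
            linarith
    · rw [div_le_div_iff₀ (by linarith) (by norm_num)]
      linarith
  · have hm : (1999 : ℝ) ≤ m := by linarith
    by_cases hτm : 14 ≤ m * τ ^ 3
    · refine le_trans ?_ (two_mul_capMass_le_capMass hf hτ0 hτ1 hτm)
      rw [ENNReal.ofReal_mul (by norm_num), ENNReal.ofReal_ofNat, ← hcap]
      gcongr
      exact capMass_prod_le he hf hτ0.le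
    · exfalso
      have hm0 : (0 : ℝ) < m := by linarith
      -- The height is below `x`, where `m x ^ 3 = 14`, so that `L ≤ 127 / x` and
      -- `L ^ 3 ≤ 127 ^ 3 * m / 14`, which is less than the assumed lower bound.
      set x : ℝ := (14 / m : ℝ) ^ (1 / 3 : ℝ) with hxdef
      have hx : 0 < x := by positivity
      have hx3 : x ^ 3 = 14 / m := by
        rw [hxdef, ← Real.rpow_natCast, ← Real.rpow_mul (by positivity)]
        norm_num
      have hxm : m * x ^ 3 = 14 := by
        rw [hx3]
        field_simp
      have hx5 : x ≤ 1 / 5 := by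
        refine (pow_le_pow_iff_left₀ hx.le (by norm_num) three_ne_zero).1 ?_
        rw [hx3, div_le_iff₀ hm0]
        linarith
      have hτx : τ ≤ x := by
        refine (pow_le_pow_iff_left₀ hτ0.le hx.le three_ne_zero).1 ?_
        rw [hx3, le_div_iff₀ hm0]
        linarith
      have h := log_le_of_low_cap he finrank_toLp_prod hx hx5 hxm hτx hp hcap
      have h3 : L ^ 3 ≤ (127 / x) ^ 3 := pow_le_pow_left₀ (by linarith) h 3
      have h4 : (127 / x) ^ 3 = 127 ^ 3 * m / 14 := by
        rw [div_pow, hx3]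
        field_simp
      rw [h4] at h3
      have h5 := hdim.trans h3
      nlinarith

end Signal

/-- On a line, nonempty caps contain half of the sphere. -/
theorem half_le_capMass_of_finrank_eq_one {E : Type*} [NormedAddCommGroup E]
    [InnerProductSpace ℝ E] [FiniteDimensional ℝ E] [MeasurableSpace E] [BorelSpace E]
    (hE : Module.finrank ℝ E = 1) {e : E} (he : ‖e‖ = 1) {τ : ℝ} (hτ : τ ≤ 1) :
    1 / 2 ≤ capMass e τ := by
  refine (half_le_capMass he le_rfl).trans ?_
  refine measure_mono fun v hv => hτ.trans ?_
  have hv0 : 0 ≤ inner ℝ e (v : E) := hv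
  obtain ⟨c, hc⟩ := (finrank_eq_one_iff_of_nonzero' e
    (fun h => by simp [h] at he)).1 hE (v : E)
  have hn := norm_eq_of_mem_sphere v
  rw [← hc, norm_smul, he, mul_one, Real.norm_eq_abs] at hn
  rw [← hc, inner_smul_right, real_inner_self_eq_norm_sq, he] at hv0 ⊢
  rw [abs_of_nonneg (by linarith)] at hn
  rw [hn]
  norm_num

/-- The threshold equation with a small positive probability determines the mass of all caps,
and forces the dimension to be at least `2`. -/
theorem two_le_and_capMass_eq {r : ℕ} {p τ : ℝ} (h : IsThreshold r p τ) (hp : 0 < p)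
    (hp' : p < 1 / 2) : 2 ≤ r ∧ ∀ e : EuclideanSpace ℝ (Fin r), ‖e‖ = 1 →
      capMass e τ = ENNReal.ofReal p := by
  have hcap : ∀ e : EuclideanSpace ℝ (Fin r), ‖e‖ = 1 → capMass e τ = ENNReal.ofReal p := by
    intro e he
    have := nontrivial_of_norm_eq_one he
    rw [← sphereLaw_prod_eq_capMass he]
    exact h
  refine ⟨?_, hcap⟩
  by_contra hr
  interval_cases r
  · rw [IsThreshold, uniformSphere_eq, sphereLaw,
      (Measure.toSphere_eq_zero_iff_finrank (volume : Measure (EuclideanSpace ℝ (Fin 0)))).2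
        (by simp)] at h
    simp only [smul_zero, Measure.zero_prod, Measure.coe_zero, Pi.zero_apply] at h
    rw [eq_comm, ENNReal.ofReal_eq_zero] at h
    linarith
  · have he : ‖EuclideanSpace.single (0 : Fin 1) (1 : ℝ)‖ = 1 := by simp
    have hc := hcap _ he
    rcases le_or_gt τ 1 with hτ | hτ
    · have h2 := half_le_capMass_of_finrank_eq_one (by simp) he hτ
      rw [hc, show (1 / 2 : ℝ≥0∞) = ENNReal.ofReal (1 / 2) by
        rw [ENNReal.ofReal_div_of_pos (by norm_num)]; simp,
        ENNReal.ofReal_le_ofReal_iff hp.le] at h2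
      linarith
    · rw [capMass_eq_zero he hτ, eq_comm, ENNReal.ofReal_eq_zero] at hc
      linarith

/-- The probability that three independent uniform unit vectors of `ℝ^r` have all pairwise inner
products at least `τ`, conditioned on the first one. By rotation invariance this does not depend on
the first vector, so that the supremum is over equal values; it spares the choice of a vector. -/
def triangleProb (r : ℕ) (τ : ℝ) : ℝ≥0∞ :=
  ⨆ e : UnitSphere r, triangleMass (e : EuclideanSpace ℝ (Fin r)) τ

theorem triangleMass_eq_triangleProb {r : ℕ} {e : EuclideanSpace ℝ (Fin r)} (he : ‖e‖ = 1)
    (τ : ℝ) : triangleMass e τ = triangleProb r τ := by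
  have := nontrivial_of_norm_eq_one he
  have : Nonempty (UnitSphere r) := ⟨⟨e, by simpa using he⟩⟩
  have h : ∀ v : UnitSphere r, triangleMass (v : EuclideanSpace ℝ (Fin r)) τ = triangleMass e τ :=
    fun v => triangleMass_eq rfl (norm_eq_of_mem_sphere v) he τ
  simp [triangleProb, h]

/-- The signal bound for the models at hand, with the dimension split as `1 + (r - 1)`. -/
theorem two_mul_cube_le_triangleProb {r : ℕ} {p τ : ℝ} (h : IsThreshold r p τ) (hp : 0 < p)
    (hL : 4000 ≤ Real.log (1 / p)) (hdim : r * (127 : ℝ) ^ 3 ≤ Real.log (1 / p) ^ 3) :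
    ENNReal.ofReal (2 * p ^ 3) ≤ triangleProb r τ := by
  have hp2 : p < 1 / 2 := by
    have h1 := Real.log_le_sub_one_of_pos (one_div_pos.2 hp)
    have h2 : 2 < 1 / p := by linarith
    rw [lt_div_iff₀ hp] at h2
    linarith
  obtain ⟨hr, hcap⟩ := two_le_and_capMass_eq h hp hp2
  obtain ⟨m, rfl⟩ := Nat.exists_eq_add_of_le' (show 1 ≤ r by omega)
  have hm : 0 < m := by omega
  have hf : ‖EuclideanSpace.single (⟨0, hm⟩ : Fin m) (1 : ℝ)‖ = 1 := by simp
  have he : ‖EuclideanSpace.single (0 : Fin (m + 1)) (1 : ℝ)‖ = 1 := by simp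
  have he' : ‖WithLp.toLp 2 ((1 : ℝ), (0 : EuclideanSpace ℝ (Fin m)))‖ = 1 := by simp
  have := nontrivial_of_norm_eq_one he
  have := nontrivial_of_norm_eq_one he'
  have hrank : Module.finrank ℝ (EuclideanSpace ℝ (Fin (m + 1))) =
      Module.finrank ℝ (WithLp 2 (ℝ × EuclideanSpace ℝ (Fin m))) := by
    rw [finrank_toLp_prod]; simp
  rw [← triangleMass_eq_triangleProb he, triangleMass_eq hrank he he']
  refine two_mul_cube_le_triangleMass hf he' hp ?_ hL ?_
  · rw [← capMass_eq hrank he he', hcap _ he]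
  · simpa using hdim

/-! ### Clique probabilities with independent edges -/

instance (n : ℕ) : MeasurableSingletonClass (SimpleGraph (Fin n)) where
  measurableSet_singleton G := by
    have h : ({G} : Set (SimpleGraph (Fin n))) = SimpleGraph.edgeSet ⁻¹' {G.edgeSet} := by
      ext H
      simp
    rw [h]
    exact SimpleGraph.measurable_edgeSet (Set.toFinite _).measurableSet

/-- The event that the vertices in `s` span a complete subgraph. -/
def cliqueEvent {n : ℕ} (s : Finset (Fin n)) : Set (SimpleGraph (Fin n)) :=
  {G | G.IsClique (s : Set (Fin n))}

/-- The first and second moment properties of a random graph that the analysis of the triangle test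
uses: `p` is the edge probability and `q` the triangle probability, distinct edges are pairwise
(at most) uncorrelated, and so are triangles with at most one common vertex. For
triangles with a common edge there is the trivial bound by a triangle with an independent edge. -/
structure CliqueMoments {n : ℕ} (Q : Measure (SimpleGraph (Fin n))) (p q : ℝ) : Prop where
  edge : ∀ s : Finset (Fin n), s.card = 2 → Q.real (cliqueEvent s) = p
  edge_pair : ∀ s t : Finset (Fin n), s.card = 2 → t.card = 2 → s ≠ t →
    Q.real (cliqueEvent s ∩ cliqueEvent t) ≤ p ^ 2
  triangle : ∀ s : Finset (Fin n), s.card = 3 → Q.real (cliqueEvent s) = q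
  triangle_pair : ∀ s t : Finset (Fin n), s.card = 3 → t.card = 3 → (s ∩ t).card ≤ 1 →
    Q.real (cliqueEvent s ∩ cliqueEvent t) ≤ q ^ 2
  triangle_pair_edge : ∀ s t : Finset (Fin n), s.card = 3 → t.card = 3 → (s ∩ t).card = 2 →
    Q.real (cliqueEvent s ∩ cliqueEvent t) ≤ p * q

/-- The edges of the complete graph on `s`. -/
def cliqueEdges {n : ℕ} (s : Finset (Fin n)) : Finset (Sym2 (Fin n)) :=
  s.offDiag.image (Function.uncurry Sym2.mk)

theorem mk_mem_cliqueEdges {n : ℕ} {s : Finset (Fin n)} {a b : Fin n} :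
    s(a, b) ∈ cliqueEdges s ↔ a ∈ s ∧ b ∈ s ∧ a ≠ b := by
  simp only [cliqueEdges, Finset.mem_image, Finset.mem_offDiag, Prod.exists,
    Function.uncurry_apply_pair, Sym2.eq_iff]
  constructor
  · rintro ⟨x, y, ⟨hx, hy, hxy⟩, ⟨rfl, rfl⟩ | ⟨rfl, rfl⟩⟩
    · exact ⟨hx, hy, hxy⟩
    · exact ⟨hy, hx, hxy.symm⟩
  · rintro ⟨ha, hb, hab⟩
    exact ⟨a, b, ⟨ha, hb, hab⟩, Or.inl ⟨rfl, rfl⟩⟩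

theorem cliqueEvent_eq {n : ℕ} (s : Finset (Fin n)) :
    cliqueEvent s = {G | (cliqueEdges s : Set (Sym2 (Fin n))) ⊆ G.edgeSet} := by
  ext G
  simp only [cliqueEvent, Set.mem_ofPred_eq, SimpleGraph.isClique_iff]
  constructor
  · intro h e he
    induction e with | _ a b
    obtain ⟨ha, hb, hab⟩ := mk_mem_cliqueEdges.1 (Finset.mem_coe.1 he)
    exact h ha hb hab
  · intro h a ha b hb hab
    exact h (Finset.mem_coe.2 (mk_mem_cliqueEdges.2 ⟨ha, hb, hab⟩))

/-- Under independent edges, all edges of `F` are present with probability `p ^ #F`. -/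
theorem binomialRandom_subset_edgeSet {n : ℕ} (p : unitInterval) (F : Finset (Sym2 (Fin n)))
    (hF : ∀ e ∈ F, ¬ e.IsDiag) :
    (SimpleGraph.binomialRandom (Fin n) p).real {G | (F : Set (Sym2 (Fin n))) ⊆ G.edgeSet} =
      (p : ℝ) ^ F.card := by
  have hmeas : MeasurableSet {G : SimpleGraph (Fin n) | (F : Set (Sym2 (Fin n))) ⊆ G.edgeSet} :=
    (Set.toFinite _).measurableSet
  have hmap : Measurable fun p : Sym2 (Fin n) → Prop => {i | p i} :=
    MeasurableEquiv.setOfPred.measurable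
  have hpre : (fun p : Sym2 (Fin n) → Prop => {i | p i}) ⁻¹' (SimpleGraph.fromEdgeSet ⁻¹'
      {G : SimpleGraph (Fin n) | (F : Set (Sym2 (Fin n))) ⊆ G.edgeSet}) =
      Set.pi F fun _ => {True} := by
    ext S
    simp only [Set.mem_preimage, Set.mem_ofPred_eq, SimpleGraph.edgeSet_fromEdgeSet, Set.mem_pi,
      Finset.mem_coe, Set.mem_singleton_iff, eq_iff_iff, iff_true]
    constructor
    · intro h e he
      exact (h (Finset.mem_coe.2 he)).1
    · intro h e he
      exact ⟨h e he, hF e he⟩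
  rw [measureReal_def, SimpleGraph.binomialRandom_eq_map,
    Measure.map_apply SimpleGraph.measurable_fromEdgeSet hmeas,
    ProbabilityTheory.setBernoulli_eq_map,
    Measure.map_apply hmap (SimpleGraph.measurable_fromEdgeSet hmeas), hpre,
    Measure.infinitePi_pi _ (fun _ _ => MeasurableSet.of_discrete)]
  rw [Finset.prod_congr rfl (g := fun _ => (unitInterval.toNNReal p : ℝ≥0∞))]
  · simp
  · intro e he
    have := hF e he
    simp [this]

theorem not_isDiag_of_mem_cliqueEdges {n : ℕ} {s : Finset (Fin n)} {e : Sym2 (Fin n)}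
    (he : e ∈ cliqueEdges s) : ¬ e.IsDiag := by
  induction e with | _ a b
  exact (mk_mem_cliqueEdges.1 he).2.2

theorem card_cliqueEdges {n : ℕ} (s : Finset (Fin n)) :
    (cliqueEdges s).card = s.card.choose 2 := Sym2.card_image_offDiag s

theorem disjoint_cliqueEdges {n : ℕ} {s t : Finset (Fin n)} (h : (s ∩ t).card ≤ 1) :
    Disjoint (cliqueEdges s) (cliqueEdges t) := by
  rw [Finset.disjoint_left]
  intro e hs ht
  induction e with | _ a b
  obtain ⟨has, hbs, hab⟩ := mk_mem_cliqueEdges.1 hs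
  obtain ⟨hat, hbt, -⟩ := mk_mem_cliqueEdges.1 ht
  exact hab (Finset.card_le_one.1 h a (by simp [has, hat]) b (by simp [hbs, hbt]))

theorem cliqueEvent_inter {n : ℕ} (s t : Finset (Fin n)) : cliqueEvent s ∩ cliqueEvent t =
    {G | ((cliqueEdges s ∪ cliqueEdges t : Finset _) : Set (Sym2 (Fin n))) ⊆ G.edgeSet} := by
  rw [cliqueEvent_eq, cliqueEvent_eq]
  ext G
  simp

theorem binomialRandom_cliqueEvent {n : ℕ} (p : unitInterval) (s : Finset (Fin n)) :
    (SimpleGraph.binomialRandom (Fin n) p).real (cliqueEvent s) = (p : ℝ) ^ s.card.choose 2 := by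
  rw [cliqueEvent_eq, binomialRandom_subset_edgeSet p _ fun e => not_isDiag_of_mem_cliqueEdges,
    card_cliqueEdges]

theorem binomialRandom_cliqueEvent_inter {n : ℕ} (p : unitInterval) (s t : Finset (Fin n)) :
    (SimpleGraph.binomialRandom (Fin n) p).real (cliqueEvent s ∩ cliqueEvent t) =
      (p : ℝ) ^ (cliqueEdges s ∪ cliqueEdges t).card := by
  rw [cliqueEvent_inter, binomialRandom_subset_edgeSet]
  intro e he
  rcases Finset.mem_union.1 he with h | h <;> exact not_isDiag_of_mem_cliqueEdges h

theorem card_inter_le_one_of_ne {α : Type*} [DecidableEq α] {s t : Finset α} (hs : s.card = 2)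
    (ht : t.card = 2) (h : s ≠ t) : (s ∩ t).card ≤ 1 := by
  by_contra hlt
  have h1 : s ∩ t = s := Finset.eq_of_subset_of_card_le Finset.inter_subset_left (by omega)
  have h2 : s ∩ t = t := Finset.eq_of_subset_of_card_le Finset.inter_subset_right (by omega)
  exact h (h1.symm.trans h2)

/-- Of two triangles with a common edge, the second has an edge from a common vertex `i` to a vertex
`l` outside the first. -/
theorem exists_edge_of_card_inter {α : Type*} [DecidableEq α] {s t : Finset α}
    (ht : t.card = 3) (h : (s ∩ t).card = 2) : ∃ l ∈ t, l ∉ s ∧ ∃ i ∈ s, i ∈ t := by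
  have h1 : (t \ s).card = 1 := by
    have := Finset.card_sdiff_add_card_inter t s
    rw [Finset.inter_comm] at this
    omega
  obtain ⟨l, hl⟩ := Finset.card_pos.1 (by omega : 0 < (t \ s).card)
  obtain ⟨i, hi⟩ := Finset.card_pos.1 (by omega : 0 < (s ∩ t).card)
  rw [Finset.mem_sdiff] at hl
  rw [Finset.mem_inter] at hi
  exact ⟨l, hl.1, hl.2, i, hi.1, hi.2⟩

theorem cliqueMoments_binomialRandom {n : ℕ} (p : unitInterval) :
    CliqueMoments (SimpleGraph.binomialRandom (Fin n) p) p ((p : ℝ) ^ 3) where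
  edge s hs := by rw [binomialRandom_cliqueEvent, hs]; simp
  triangle s hs := by rw [binomialRandom_cliqueEvent, hs]; simp [Nat.choose]
  edge_pair s t hs ht hst := by
    rw [binomialRandom_cliqueEvent_inter, Finset.card_union_of_disjoint
      (disjoint_cliqueEdges (card_inter_le_one_of_ne hs ht hst)), card_cliqueEdges,
      card_cliqueEdges, hs, ht]
    simp
  triangle_pair s t hs ht hst := by
    rw [binomialRandom_cliqueEvent_inter, Finset.card_union_of_disjoint
      (disjoint_cliqueEdges hst), card_cliqueEdges, card_cliqueEdges, hs, ht, ← pow_mul]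
    simp [Nat.choose]
  triangle_pair_edge s t hs ht hst := by
    obtain ⟨l, hlt, hls, i, his, hit⟩ := exists_edge_of_card_inter ht hst
    rw [binomialRandom_cliqueEvent_inter, ← pow_succ']
    refine pow_le_pow_of_le_one p.2.1 p.2.2 ?_
    have hnot : s(i, l) ∉ cliqueEdges s := fun h => hls (mk_mem_cliqueEdges.1 h).2.1
    have hcard : (insert s(i, l) (cliqueEdges s)).card = 4 := by
      rw [Finset.card_insert_of_notMem hnot, card_cliqueEdges, hs]
      rfl
    refine hcard.ge.trans ?_
    refine Finset.card_le_card (Finset.insert_subset ?_ Finset.subset_union_left)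
    refine Finset.mem_union_right _ (mk_mem_cliqueEdges.2 ⟨hit, hlt, ?_⟩)
    rintro rfl
    exact hls his

/-! ### Clique probabilities in the geometric graph -/

section Geometric

variable {n r : ℕ}

/-- The inner product of the positions of two vertices. -/
def posInner (x : Fin n → UnitSphere r) (i j : Fin n) : ℝ :=
  inner ℝ (x i : EuclideanSpace ℝ (Fin r)) (x j : EuclideanSpace ℝ (Fin r))

theorem measurable_posInner (i j : Fin n) :
    Measurable fun x : Fin n → UnitSphere r => posInner x i j := by
  have h : Continuous fun x : Fin n → UnitSphere r => posInner x i j := by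
    unfold posInner
    fun_prop
  exact h.measurable

variable [NeZero r]

instance : IsProbabilityMeasure (uniformSphere r) := by
  rw [uniformSphere_eq]
  infer_instance

/-- Integrating out the position of `j`, the edge `ij` is present with probability `p`, whatever the
positions of the other vertices are. -/
theorem pi_edge_inter {τ : ℝ} {p : ℝ≥0∞}
    (hp : ∀ e : EuclideanSpace ℝ (Fin r), ‖e‖ = 1 → capMass e τ = p) {i j : Fin n} (hij : i ≠ j)
    {B : Set (Fin n → UnitSphere r)} (hB : MeasurableSet B)
    (hBj : ∀ x y, Function.update x j y ∈ B ↔ x ∈ B) :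
    (Measure.pi fun _ : Fin n => uniformSphere r) ({x | τ ≤ posInner x i j} ∩ B) =
      p * (Measure.pi fun _ : Fin n => uniformSphere r) B := by
  classical
  have hA : MeasurableSet ({x : Fin n → UnitSphere r | τ ≤ posInner x i j} ∩ B) :=
    (measurableSet_le measurable_const (measurable_posInner i j)).inter hB
  rw [← lintegral_indicator_one hA, ← lintegral_indicator_one hB,
    ← lintegral_const_mul _ (measurable_one.indicator hB)]
  refine lintegral_eq_of_lmarginal_eq {j} (measurable_one.indicator hA)
    ((measurable_one.indicator hB).const_mul _) ?_
  rw [lmarginal_singleton, lmarginal_singleton]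
  funext x
  by_cases hx : x ∈ B
  · have h1 : ∀ y : UnitSphere r, ({x : Fin n → UnitSphere r | τ ≤ posInner x i j} ∩ B).indicator
        (1 : (Fin n → UnitSphere r) → ℝ≥0∞) (Function.update x j y) =
        {y : UnitSphere r | τ ≤ inner ℝ (x i : EuclideanSpace ℝ (Fin r))
          (y : EuclideanSpace ℝ (Fin r))}.indicator 1 y := by
      intro y
      simp only [Set.indicator_apply, Set.mem_inter_iff, Set.mem_ofPred_eq, posInner, hBj, hx,
        and_true, Function.update_self, Function.update_of_ne hij, Pi.one_apply]
    simp only [h1]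
    rw [lintegral_indicator_one (measurableSet_cap _ _)]
    simp only [Set.indicator_apply, hBj, hx, if_true, Pi.one_apply, mul_one, lintegral_const,
      measure_univ]
    exact hp _ (norm_eq_of_mem_sphere (x i))
  · simp [hBj, hx]

/-- Integrating out the positions of `j` and `k`, the triangle `ijk` is present with probability
`q`, whatever the positions of the other vertices are. -/
theorem pi_triangle_inter {τ : ℝ} {i j k : Fin n} (hij : i ≠ j) (hik : i ≠ k) (hjk : j ≠ k)
    {B : Set (Fin n → UnitSphere r)} (hB : MeasurableSet B)
    (hBj : ∀ x y, Function.update x j y ∈ B ↔ x ∈ B)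
    (hBk : ∀ x y, Function.update x k y ∈ B ↔ x ∈ B) :
    (Measure.pi fun _ : Fin n => uniformSphere r)
      ({x | τ ≤ posInner x i j ∧ τ ≤ posInner x i k ∧ τ ≤ posInner x j k} ∩ B) =
      triangleProb r τ * (Measure.pi fun _ : Fin n => uniformSphere r) B := by
  classical
  have hT : MeasurableSet {x : Fin n → UnitSphere r |
      τ ≤ posInner x i j ∧ τ ≤ posInner x i k ∧ τ ≤ posInner x j k} := by
    rw [Set.ofPred_and, Set.ofPred_and]
    exact (measurableSet_le measurable_const (measurable_posInner i j)).inter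
      ((measurableSet_le measurable_const (measurable_posInner i k)).inter
        (measurableSet_le measurable_const (measurable_posInner j k)))
  have hA := hT.inter hB
  rw [← lintegral_indicator_one hA, ← lintegral_indicator_one hB,
    ← lintegral_const_mul _ (measurable_one.indicator hB)]
  refine lintegral_eq_of_lmarginal_eq {j, k} (measurable_one.indicator hA)
    ((measurable_one.indicator hB).const_mul _) ?_
  funext x
  rw [lmarginal_insert _ (measurable_one.indicator hA) (by simpa using hjk),
    lmarginal_insert _ ((measurable_one.indicator hB).const_mul _) (by simpa using hjk),
    lmarginal_singleton, lmarginal_singleton]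
  by_cases hx : x ∈ B
  · have h1 : ∀ y z : UnitSphere r, ({x : Fin n → UnitSphere r |
          τ ≤ posInner x i j ∧ τ ≤ posInner x i k ∧ τ ≤ posInner x j k} ∩ B).indicator
        (1 : (Fin n → UnitSphere r) → ℝ≥0∞) (Function.update (Function.update x j y) k z) =
        {z : UnitSphere r × UnitSphere r | τ ≤ inner ℝ (x i : EuclideanSpace ℝ (Fin r))
          (z.1 : EuclideanSpace ℝ (Fin r)) ∧ τ ≤ inner ℝ (x i : EuclideanSpace ℝ (Fin r))
          (z.2 : EuclideanSpace ℝ (Fin r)) ∧ τ ≤ inner ℝ (z.1 : EuclideanSpace ℝ (Fin r))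
          (z.2 : EuclideanSpace ℝ (Fin r))}.indicator 1 (y, z) := by
      intro y z
      simp only [Set.indicator_apply, Set.mem_inter_iff, Set.mem_ofPred_eq, posInner, hBj, hBk, hx,
        and_true, Function.update_self, Function.update_of_ne hij, Function.update_of_ne hik,
        Function.update_of_ne hjk, Pi.one_apply]
    simp only [h1]
    rw [← lintegral_prod _ ((measurable_one.indicator (measurableSet_triangle _ _)).aemeasurable),
      lintegral_indicator_one (measurableSet_triangle _ _)]
    simp only [Set.indicator_apply, hBj, hBk, hx, if_true, Pi.one_apply, mul_one, lintegral_const,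
      measure_univ]
    exact triangleMass_eq_triangleProb (norm_eq_of_mem_sphere (x i)) τ
  · simp [hBj, hBk, hx]

omit [NeZero r] in
theorem geomGraph_preimage_cliqueEvent (τ : ℝ) (s : Finset (Fin n)) :
    geomGraph τ ⁻¹' cliqueEvent s =
      {x : Fin n → UnitSphere r | ∀ a ∈ s, ∀ b ∈ s, a ≠ b → τ ≤ posInner x a b} := by
  ext x
  simp only [cliqueEvent, Set.mem_preimage, Set.mem_ofPred_eq, SimpleGraph.isClique_iff]
  constructor
  · intro h a ha b hb hab
    exact (h ha hb hab).2
  · intro h a ha b hb hab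
    exact ⟨hab, h a ha b hb hab⟩

omit [NeZero r] in
theorem measurableSet_cliqueEvent (s : Finset (Fin n)) : MeasurableSet (cliqueEvent s) :=
  (Set.toFinite _).measurableSet

omit [NeZero r] in
theorem update_mem_geomGraph_preimage {τ : ℝ} {s : Finset (Fin n)} {j : Fin n} (hj : j ∉ s)
    (x : Fin n → UnitSphere r) (y : UnitSphere r) :
    Function.update x j y ∈ geomGraph τ ⁻¹' cliqueEvent s ↔
      x ∈ geomGraph τ ⁻¹' cliqueEvent s := by
  rw [geomGraph_preimage_cliqueEvent]
  refine forall₂_congr fun a ha => forall₂_congr fun b hb => imp_congr_right fun _ => ?_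
  rw [posInner, posInner, Function.update_of_ne (ne_of_mem_of_not_mem ha hj),
    Function.update_of_ne (ne_of_mem_of_not_mem hb hj)]

omit [NeZero r] in
theorem posInner_comm (x : Fin n → UnitSphere r) (i j : Fin n) :
    posInner x i j = posInner x j i := real_inner_comm _ _

omit [NeZero r] in
theorem geomGraph_preimage_pair (τ : ℝ) {i j : Fin n} (hij : i ≠ j) :
    geomGraph τ ⁻¹' cliqueEvent {i, j} = {x : Fin n → UnitSphere r | τ ≤ posInner x i j} := by
  rw [geomGraph_preimage_cliqueEvent]
  ext x
  simp only [Set.mem_ofPred_eq, Finset.mem_insert, Finset.mem_singleton, forall_eq_or_imp,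
    forall_eq, ne_eq, not_true_eq_false, false_implies, true_and, and_true, hij, hij.symm,
    not_false_eq_true, true_implies, posInner_comm x j i, and_self]

omit [NeZero r] in
theorem geomGraph_preimage_triple (τ : ℝ) {i j k : Fin n} (hij : i ≠ j) (hik : i ≠ k)
    (hjk : j ≠ k) : geomGraph τ ⁻¹' cliqueEvent {i, j, k} = {x : Fin n → UnitSphere r |
      τ ≤ posInner x i j ∧ τ ≤ posInner x i k ∧ τ ≤ posInner x j k} := by
  rw [geomGraph_preimage_cliqueEvent]
  ext x
  simp only [Set.mem_ofPred_eq, Finset.mem_insert, Finset.mem_singleton, forall_eq_or_imp,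
    forall_eq, ne_eq, not_true_eq_false, false_implies, true_and, and_true, hij, hij.symm, hik,
    hik.symm, hjk, hjk.symm, not_false_eq_true, true_implies, posInner_comm x j i,
    posInner_comm x k i, posInner_comm x k j]
  tauto

omit [NeZero r] in
theorem measurableSet_geomGraph_preimage (τ : ℝ) (s : Finset (Fin n)) :
    MeasurableSet (geomGraph τ ⁻¹' cliqueEvent s : Set (Fin n → UnitSphere r)) :=
  measurable_geomGraph τ (measurableSet_cliqueEvent s)

theorem geomLaw_pair_inter {τ : ℝ} {p : ℝ≥0∞}
    (hp : ∀ e : EuclideanSpace ℝ (Fin r), ‖e‖ = 1 → capMass e τ = p) {i j : Fin n}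
    {t : Finset (Fin n)} (hij : i ≠ j) (hj : j ∉ t) :
    geomLaw n r τ (cliqueEvent {i, j} ∩ cliqueEvent t) = p * geomLaw n r τ (cliqueEvent t) := by
  rw [geomLaw, Measure.map_apply (measurable_geomGraph τ) (measurableSet_cliqueEvent t),
    Measure.map_apply (measurable_geomGraph τ)
      ((measurableSet_cliqueEvent _).inter (measurableSet_cliqueEvent t)), Set.preimage_inter,
    geomGraph_preimage_pair τ hij, pi_edge_inter hp hij (measurableSet_geomGraph_preimage τ t)
      (update_mem_geomGraph_preimage hj)]

theorem geomLaw_triple_inter {τ : ℝ} {i j k : Fin n}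
    {t : Finset (Fin n)} (hij : i ≠ j) (hik : i ≠ k) (hjk : j ≠ k) (hj : j ∉ t) (hk : k ∉ t) :
    geomLaw n r τ (cliqueEvent {i, j, k} ∩ cliqueEvent t) =
      triangleProb r τ * geomLaw n r τ (cliqueEvent t) := by
  rw [geomLaw, Measure.map_apply (measurable_geomGraph τ) (measurableSet_cliqueEvent t),
    Measure.map_apply (measurable_geomGraph τ)
      ((measurableSet_cliqueEvent _).inter (measurableSet_cliqueEvent t)), Set.preimage_inter,
    geomGraph_preimage_triple τ hij hik hjk, pi_triangle_inter hij hik hjk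
      (measurableSet_geomGraph_preimage τ t) (update_mem_geomGraph_preimage hj)
      (update_mem_geomGraph_preimage hk)]

instance (τ : ℝ) : IsProbabilityMeasure (geomLaw n r τ) :=
  Measure.isProbabilityMeasure_map (measurable_geomGraph τ).aemeasurable

omit [NeZero r] in
theorem cliqueEvent_empty : cliqueEvent (∅ : Finset (Fin n)) = Set.univ := by
  ext G
  simp [cliqueEvent]

theorem geomLaw_pair {τ : ℝ} {p : ℝ≥0∞}
    (hp : ∀ e : EuclideanSpace ℝ (Fin r), ‖e‖ = 1 → capMass e τ = p) {s : Finset (Fin n)}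
    (hs : s.card = 2) : geomLaw n r τ (cliqueEvent s) = p := by
  obtain ⟨i, j, hij, rfl⟩ := Finset.card_eq_two.1 hs
  have h := geomLaw_pair_inter hp hij (Finset.notMem_empty j)
  simpa [cliqueEvent_empty] using h

theorem geomLaw_triple {τ : ℝ} {s : Finset (Fin n)} (hs : s.card = 3) :
    geomLaw n r τ (cliqueEvent s) = triangleProb r τ := by
  obtain ⟨i, j, k, hij, hik, hjk, rfl⟩ := Finset.card_eq_three.1 hs
  have h := geomLaw_triple_inter (τ := τ) (r := r) hij hik hjk (Finset.notMem_empty j)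
    (Finset.notMem_empty k)
  simpa [cliqueEvent_empty] using h

theorem cliqueMoments_geomLaw {τ : ℝ} {p : ℝ} (hp0 : 0 ≤ p)
    (hp : ∀ e : EuclideanSpace ℝ (Fin r), ‖e‖ = 1 → capMass e τ = ENNReal.ofReal p) :
    CliqueMoments (geomLaw n r τ) p (triangleProb r τ).toReal where
  edge s hs := by rw [measureReal_def, geomLaw_pair hp hs, ENNReal.toReal_ofReal hp0]
  triangle s hs := by rw [measureReal_def, geomLaw_triple hs]
  edge_pair s t hs ht hst := by
    obtain ⟨j, hjs, hjt⟩ : ∃ j ∈ s, j ∉ t := by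
      by_contra! h
      exact hst (Finset.eq_of_subset_of_card_le h (by omega))
    obtain ⟨i, hi⟩ := Finset.card_eq_one.1
      (by rw [Finset.card_erase_of_mem hjs, hs] : (s.erase j).card = 1)
    have hsij : s = {i, j} := by
      rw [← Finset.insert_erase hjs, hi, Finset.pair_comm]
    have hij : i ≠ j := Finset.ne_of_mem_erase (hi ▸ Finset.mem_singleton_self i)
    rw [measureReal_def, hsij, geomLaw_pair_inter hp hij hjt, geomLaw_pair hp ht,
      ENNReal.toReal_mul, ENNReal.toReal_ofReal hp0, sq]
  triangle_pair s t hs ht hst := by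
    have h2 : 1 < (s \ t).card := by
      have := Finset.card_sdiff_add_card_inter s t
      omega
    obtain ⟨j, hj, k, hk, hjk⟩ := Finset.one_lt_card.1 h2
    rw [Finset.mem_sdiff] at hj hk
    have hk' : k ∈ s.erase j := Finset.mem_erase.2 ⟨hjk.symm, hk.1⟩
    obtain ⟨i, hi⟩ := Finset.card_eq_one.1 (by
      rw [Finset.card_erase_of_mem hk', Finset.card_erase_of_mem hj.1, hs] :
      ((s.erase j).erase k).card = 1)
    have hi' : i ∈ (s.erase j).erase k := hi ▸ Finset.mem_singleton_self i
    have hik : i ≠ k := Finset.ne_of_mem_erase hi'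
    have hij : i ≠ j := Finset.ne_of_mem_erase (Finset.mem_of_mem_erase hi')
    have hsijk : s = {i, j, k} := by
      rw [← Finset.insert_erase hj.1, ← Finset.insert_erase hk', hi]
      ext a
      simp only [Finset.mem_insert, Finset.mem_singleton]
      tauto
    rw [measureReal_def, hsijk, geomLaw_triple_inter hij hik hjk hj.2 hk.2, geomLaw_triple ht,
      ENNReal.toReal_mul, sq]
  triangle_pair_edge s t hs ht hst := by
    obtain ⟨l, hlt, hls, i, his, hit⟩ := exists_edge_of_card_inter ht hst
    have hil : i ≠ l := fun h => hls (h ▸ his)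
    have hsub : cliqueEvent s ∩ cliqueEvent t ⊆ cliqueEvent {i, l} ∩ cliqueEvent s := by
      rintro G ⟨h1, h2⟩
      refine ⟨h2.subset ?_, h1⟩
      simp [Set.insert_subset_iff, hit, hlt]
    refine (measureReal_mono hsub).trans ?_
    rw [measureReal_def, geomLaw_pair_inter hp hil hls, geomLaw_triple hs,
      ENNReal.toReal_mul, ENNReal.toReal_ofReal hp0]

end Geometric

/-! ### Concentration of the edge and triangle counts -/

/-- The number of events in a finite family that occur. -/
def eventCount {ι Ω : Type*} (I : Finset ι) (A : ι → Set Ω) (ω : Ω) : ℝ :=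
  ∑ s ∈ I, (A s).indicator 1 ω

/-- Chebyshev's inequality for the number of events that occur. -/
theorem measureReal_le_abs_eventCount_sub {ι Ω : Type*} [MeasurableSpace Ω] [Finite Ω]
    [MeasurableSingletonClass Ω] (Q : Measure Ω) [IsProbabilityMeasure Q] (I : Finset ι)
    (A : ι → Set Ω) {μ V a : ℝ} (hμ : ∑ s ∈ I, Q.real (A s) = μ)
    (hV : ∑ s ∈ I, ∑ t ∈ I, Q.real (A s ∩ A t) ≤ μ ^ 2 + V) (ha : 0 < a) :
    Q.real {ω | a ≤ |eventCount I A ω - μ|} ≤ V / a ^ 2 := by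
  have hint : ∀ f : Ω → ℝ, Integrable f Q := fun f => Integrable.of_finite
  have hmeas : ∀ S : Set Ω, MeasurableSet S := fun S => (Set.toFinite S).measurableSet
  have h1 : ∫ ω, eventCount I A ω ∂Q = μ := by
    simp only [eventCount]
    rw [integral_finsetSum _ fun _ _ => hint _, ← hμ]
    exact Finset.sum_congr rfl fun s _ => integral_indicator_one (hmeas _)
  have h2 : ∫ ω, eventCount I A ω ^ 2 ∂Q = ∑ s ∈ I, ∑ t ∈ I, Q.real (A s ∩ A t) := by
    have : ∀ ω, eventCount I A ω ^ 2 = ∑ s ∈ I, ∑ t ∈ I, (A s ∩ A t).indicator 1 ω := by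
      intro ω
      rw [sq, eventCount, Finset.sum_mul_sum]
      simp_rw [Set.inter_indicator_one, Pi.mul_apply]
    simp_rw [this]
    rw [integral_finsetSum _ fun _ _ => hint _]
    refine Finset.sum_congr rfl fun s _ => ?_
    rw [integral_finsetSum _ fun _ _ => hint _]
    exact Finset.sum_congr rfl fun t _ => integral_indicator_one (hmeas _)
  have h3 : ∫ ω, (eventCount I A ω - μ) ^ 2 ∂Q ≤ V := by
    have : ∀ ω, (eventCount I A ω - μ) ^ 2 =
        eventCount I A ω ^ 2 - 2 * μ * eventCount I A ω + μ ^ 2 := fun ω => by ring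
    simp_rw [this]
    rw [integral_add (hint _) (hint _), integral_sub (hint _) (hint _), integral_const_mul, h1, h2]
    simp
    linarith
  rw [le_div_iff₀ (by positivity), mul_comm]
  refine le_trans ?_ ((mul_meas_ge_le_integral_of_nonneg
    (Eventually.of_forall fun ω => sq_nonneg (eventCount I A ω - μ)) (hint _) (a ^ 2)).trans h3)
  refine mul_le_mul_of_nonneg_left (measureReal_mono fun ω hω => ?_) (by positivity)
  have h4 : a ^ 2 ≤ |eventCount I A ω - μ| ^ 2 := pow_le_pow_left₀ ha.le hω 2
  rwa [sq_abs] at h4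

/-- The number of complete subgraphs with `k` vertices. -/
def cliqueCount {n : ℕ} (k : ℕ) (G : SimpleGraph (Fin n)) : ℝ :=
  eventCount (Finset.powersetCard k Finset.univ) cliqueEvent G

theorem card_powersetCard_univ (n k : ℕ) :
    (Finset.powersetCard k (Finset.univ : Finset (Fin n))).card = n.choose k := by
  simp

section Moments

variable {n : ℕ} {Q : Measure (SimpleGraph (Fin n))} [IsProbabilityMeasure Q] {p q : ℝ}

theorem measureReal_edgeCount (h : CliqueMoments Q p q) {a : ℝ} (ha : 0 < a) :
    Q.real {G | a ≤ |cliqueCount 2 G - n.choose 2 * p|} ≤ n.choose 2 * p / a ^ 2 := by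
  refine measureReal_le_abs_eventCount_sub Q _ _ ?_ ?_ ha
  · rw [Finset.sum_congr rfl fun s hs => h.edge s (Finset.mem_powersetCard.1 hs).2,
      Finset.sum_const, card_powersetCard_univ, nsmul_eq_mul]
  · calc _ ≤ ∑ s ∈ Finset.powersetCard 2 (Finset.univ : Finset (Fin n)),
          ∑ t ∈ Finset.powersetCard 2 (Finset.univ : Finset (Fin n)),
            (p ^ 2 + if s = t then p else 0) := by
          refine Finset.sum_le_sum fun s hs => Finset.sum_le_sum fun t ht => ?_
          have hs2 := (Finset.mem_powersetCard.1 hs).2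
          have ht2 := (Finset.mem_powersetCard.1 ht).2
          by_cases hst : s = t
          · rw [if_pos hst, ← hst, Set.inter_self, h.edge s hs2]
            nlinarith
          · rw [if_neg hst, add_zero]
            exact h.edge_pair s t hs2 ht2 hst
      _ = _ := by
          simp only [Finset.sum_add_distrib, Finset.sum_const, Finset.sum_ite_eq,
            card_powersetCard_univ, nsmul_eq_mul]
          rw [Finset.sum_congr rfl fun s hs => if_pos hs, Finset.sum_const, card_powersetCard_univ,
            nsmul_eq_mul]
          ring

/-- A triangle shares exactly an edge with at most `3 n` others: these arise by exchanging one of its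
vertices. -/
theorem card_filter_card_inter_eq_two_le {s : Finset (Fin n)} (hs : s.card = 3) :
    ((Finset.powersetCard 3 (Finset.univ : Finset (Fin n))).filter
      fun t => (s ∩ t).card = 2).card ≤ 3 * n := by
  have hsub : ((Finset.powersetCard 3 (Finset.univ : Finset (Fin n))).filter
      fun t => (s ∩ t).card = 2) ⊆
      (s ×ˢ Finset.univ).image fun z => insert z.2 (s.erase z.1) := by
    intro t ht
    obtain ⟨ht3, hst⟩ := Finset.mem_filter.1 ht
    have ht3 := (Finset.mem_powersetCard.1 ht3).2
    obtain ⟨l, hlt, hls, -⟩ := exists_edge_of_card_inter ht3 hst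
    obtain ⟨i, his, hit, -⟩ := exists_edge_of_card_inter (s := t) hs (by rwa [Finset.inter_comm])
    refine Finset.mem_image.2 ⟨(i, l), by simp [his], ?_⟩
    have h1 : s ∩ t = s.erase i := by
      refine Finset.eq_of_subset_of_card_le (fun a ha => ?_) ?_
      · rw [Finset.mem_inter] at ha
        exact Finset.mem_erase.2 ⟨ne_of_mem_of_not_mem ha.2 hit, ha.1⟩
      · rw [Finset.card_erase_of_mem his, hs, hst]
    rw [← h1]
    refine Finset.eq_of_subset_of_card_le
      (Finset.insert_subset hlt Finset.inter_subset_right) ?_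
    rw [Finset.card_insert_of_notMem (fun h => hls (Finset.mem_inter.1 h).1), hst, ht3]
  refine (Finset.card_le_card hsub).trans (Finset.card_image_le.trans ?_)
  simp [hs]

/-- Chebyshev's inequality for the triangle count. The term `3 n p` of the variance bound
comes from the pairs of triangles with a common edge. -/
theorem measureReal_triangleCount (h : CliqueMoments Q p q) (hp : 0 ≤ p) (hq : 0 ≤ q) {a : ℝ}
    (ha : 0 < a) : Q.real {G | a ≤ |cliqueCount 3 G - n.choose 3 * q|} ≤
      n.choose 3 * q * (3 * n * p + 1) / a ^ 2 := by
  refine measureReal_le_abs_eventCount_sub Q _ _ ?_ ?_ ha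
  · rw [Finset.sum_congr rfl fun s hs => h.triangle s (Finset.mem_powersetCard.1 hs).2,
      Finset.sum_const, card_powersetCard_univ, nsmul_eq_mul]
  · calc _ ≤ ∑ s ∈ Finset.powersetCard 3 (Finset.univ : Finset (Fin n)),
          ∑ t ∈ Finset.powersetCard 3 (Finset.univ : Finset (Fin n)),
            (q ^ 2 + (if (s ∩ t).card = 2 then p * q else 0) + if s = t then q else 0) := by
          refine Finset.sum_le_sum fun s hs => Finset.sum_le_sum fun t ht => ?_
          have hs3 := (Finset.mem_powersetCard.1 hs).2
          have ht3 := (Finset.mem_powersetCard.1 ht).2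
          by_cases hst : s = t
          · subst hst
            rw [Set.inter_self, h.triangle s hs3, if_pos rfl, Finset.inter_self, hs3]
            norm_num
            positivity
          rw [if_neg hst, add_zero]
          by_cases h2 : (s ∩ t).card = 2
          · rw [if_pos h2]
            have := h.triangle_pair_edge s t hs3 ht3 h2
            nlinarith
          · rw [if_neg h2, add_zero]
            refine h.triangle_pair s t hs3 ht3 ?_
            by_contra hlt
            have h3 : (s ∩ t).card ≤ 3 := hs3 ▸ Finset.card_le_card Finset.inter_subset_left
            have e1 : s ∩ t = s :=
              Finset.eq_of_subset_of_card_le Finset.inter_subset_left (by omega)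
            have e2 : s ∩ t = t :=
              Finset.eq_of_subset_of_card_le Finset.inter_subset_right (by omega)
            exact hst (e1.symm.trans e2)
      _ ≤ ∑ s ∈ Finset.powersetCard 3 (Finset.univ : Finset (Fin n)),
            (n.choose 3 * q ^ 2 + 3 * n * (p * q) + q) := by
          refine Finset.sum_le_sum fun s hs => ?_
          have hs3 := (Finset.mem_powersetCard.1 hs).2
          simp only [Finset.sum_add_distrib, Finset.sum_const, Finset.sum_ite_eq, if_pos hs,
            card_powersetCard_univ, nsmul_eq_mul]
          rw [← Finset.sum_filter, Finset.sum_const, nsmul_eq_mul]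
          have := card_filter_card_inter_eq_two_le hs3
          have h3 : (((Finset.powersetCard 3 (Finset.univ : Finset (Fin n))).filter
            fun t => (s ∩ t).card = 2).card : ℝ) ≤ 3 * n := by exact_mod_cast this
          gcongr
      _ = _ := by
          rw [Finset.sum_const, card_powersetCard_univ, nsmul_eq_mul]
          ring

end Moments

/-! ### The statistics in terms of clique counts -/

theorem adjEntry_eq_indicator {n : ℕ} (G : SimpleGraph (Fin n)) {i j : Fin n} (h : i ≠ j) :
    adjEntry G i j = (cliqueEvent {i, j}).indicator 1 G := by
  classical
  simp [adjEntry, cliqueEvent, Set.indicator_apply, h]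

theorem adjEntry_mul_eq_indicator {n : ℕ} (G : SimpleGraph (Fin n)) {i j k : Fin n} (hij : i ≠ j)
    (hik : i ≠ k) (hjk : j ≠ k) : adjEntry G i j * adjEntry G j k * adjEntry G i k =
      (cliqueEvent {i, j, k}).indicator 1 G := by
  classical
  have : G.IsClique (({i, j, k} : Finset (Fin n)) : Set (Fin n)) ↔
      (G.Adj i j ∧ G.Adj j k) ∧ G.Adj i k := by
    simp [SimpleGraph.isClique_insert, hij, hik, hjk]
    tauto
  simp only [adjEntry, cliqueEvent, Set.indicator_apply, Set.mem_ofPred_eq, this, Pi.one_apply]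
  by_cases h1 : G.Adj i j <;> by_cases h2 : G.Adj j k <;> by_cases h3 : G.Adj i k <;>
    simp [h1, h2, h3]

theorem sum_pairs_eq {n : ℕ} (f : Finset (Fin n) → ℝ) :
    ∑ i, ∑ j ∈ Finset.Ioi i, f {i, j} = ∑ s ∈ Finset.powersetCard 2 Finset.univ, f s := by
  rw [Finset.sum_sigma']
  refine Finset.sum_nbij (fun z => {z.1, z.2}) ?_ ?_ ?_ fun _ _ => rfl
  · rintro ⟨i, j⟩ h
    have hij : i < j := by simpa using h
    simp [Finset.mem_powersetCard, Finset.card_pair hij.ne]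
  · rintro ⟨i, j⟩ h ⟨i', j'⟩ h' heq
    have hij : i < j := by simpa using h
    have hij' : i' < j' := by simpa using h'
    have h1 := Finset.ext_iff.1 heq
    simp only [Finset.mem_insert, Finset.mem_singleton] at h1
    have a1 := (h1 i).1 (Or.inl rfl)
    have a2 := (h1 j).1 (Or.inr rfl)
    have : i = i' ∧ j = j' := by grind
    simp [this.1, this.2]
  · intro s hs
    obtain ⟨x, y, hxy, rfl⟩ := Finset.card_eq_two.1 (Finset.mem_powersetCard.1 hs).2
    rcases lt_or_gt_of_ne hxy with h | h
    · exact ⟨⟨x, y⟩, by simpa using h, rfl⟩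
    · exact ⟨⟨y, x⟩, by simpa using h, Finset.pair_comm _ _⟩

theorem sum_triples_eq {n : ℕ} (f : Finset (Fin n) → ℝ) :
    ∑ i, ∑ j ∈ Finset.Ioi i, ∑ k ∈ Finset.Ioi j, f {i, j, k} =
      ∑ s ∈ Finset.powersetCard 3 Finset.univ, f s := by
  simp_rw [Finset.sum_sigma']
  refine Finset.sum_nbij (fun z => {z.1, z.2.1, z.2.2}) ?_ ?_ ?_ fun _ _ => rfl
  · rintro ⟨i, j, k⟩ h
    have hijk : i < j ∧ j < k := by simpa using h
    have := hijk.1.trans hijk.2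
    rw [Finset.mem_powersetCard]
    exact ⟨Finset.subset_univ _, Finset.card_eq_three.2
      ⟨i, j, k, hijk.1.ne, this.ne, hijk.2.ne, rfl⟩⟩
  · rintro ⟨i, j, k⟩ h ⟨i', j', k'⟩ h' heq
    have hijk : i < j ∧ j < k := by simpa using h
    have hijk' : i' < j' ∧ j' < k' := by simpa using h'
    have h1 := Finset.ext_iff.1 heq
    simp only [Finset.mem_insert, Finset.mem_singleton] at h1
    have a1 := (h1 i).1 (Or.inl rfl)
    have a2 := (h1 j).1 (Or.inr (Or.inl rfl))
    have a3 := (h1 k).1 (Or.inr (Or.inr rfl))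
    have : i = i' ∧ j = j' ∧ k = k' := by grind
    simp [this.1, this.2.1, this.2.2]
  · intro s hs
    have hs3 := (Finset.mem_powersetCard.1 hs).2
    refine ⟨⟨s.orderEmbOfFin hs3 0, s.orderEmbOfFin hs3 1, s.orderEmbOfFin hs3 2⟩, ?_, ?_⟩
    · simp
    · ext a
      have hrange : a ∈ s ↔ ∃ i, s.orderEmbOfFin hs3 i = a := by
        rw [← Finset.mem_coe, ← Finset.range_orderEmbOfFin s hs3, Set.mem_range]
      rw [hrange, Fin.exists_fin_succ, Fin.exists_fin_two]
      simp [eq_comm]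

theorem fTriangle_eq {n : ℕ} (G : SimpleGraph (Fin n)) :
    fTriangle G = cliqueCount 3 G / n.choose 3 := by
  rw [fTriangle, cliqueCount, eventCount, ← sum_triples_eq fun s => (cliqueEvent s).indicator 1 G]
  congr 1
  refine Finset.sum_congr rfl fun i _ => Finset.sum_congr rfl fun j hj =>
    Finset.sum_congr rfl fun k hk => ?_
  rw [Finset.mem_Ioi] at hj hk
  exact adjEntry_mul_eq_indicator G hj.ne (hj.trans hk).ne hk.ne

theorem edgeDensity_eq {n : ℕ} (G : SimpleGraph (Fin n)) :
    edgeDensity G = cliqueCount 2 G / n.choose 2 := by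
  rw [edgeDensity, cliqueCount, eventCount, ← sum_pairs_eq fun s => (cliqueEvent s).indicator 1 G]
  congr 1
  refine Finset.sum_congr rfl fun i _ => Finset.sum_congr rfl fun j hj => ?_
  rw [Finset.mem_Ioi] at hj
  exact adjEntry_eq_indicator G hj.ne

/-! ### The test on typical graphs -/

section Typical

variable {n : ℕ} {p q : ℝ}

/-- A graph is typical for the edge probability `p` and triangle probability `q` if its triangle
count deviates from the mean by less than the standard deviation bound times `√(log n)`, and its
edge count by less than half of the mean. -/
def Typical (p q : ℝ) (G : SimpleGraph (Fin n)) : Prop :=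
  |cliqueCount 3 G - n.choose 3 * q| <
      √(n.choose 3 * q * (3 * n * p + 1) * Real.log n) ∧
    |cliqueCount 2 G - n.choose 2 * p| < n.choose 2 * p / 2

/-- By Chebyshev's inequality, atypical triangle counts have probability at most `1 / log n` and
atypical edge counts at most `4` divided by the mean number of edges. -/
theorem measureReal_not_typical_le {Q : Measure (SimpleGraph (Fin n))} [IsProbabilityMeasure Q]
    (h : CliqueMoments Q p q) (hp : 0 < p) (hq : 0 < q) (hn : 3 ≤ n) :
    Q.real {G | ¬ Typical p q G} ≤ 1 / Real.log n + 4 / (n.choose 2 * p) := by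
  have h2 : (0 : ℝ) < n.choose 2 := by exact_mod_cast Nat.choose_pos (by omega)
  have h3 : (0 : ℝ) < n.choose 3 := by exact_mod_cast Nat.choose_pos hn
  have hlog : 0 < Real.log n := Real.log_pos (by exact_mod_cast (by omega : 1 < n))
  have hv : 0 < n.choose 3 * q * (3 * n * p + 1) := by positivity
  have hsub : {G : SimpleGraph (Fin n) | ¬ Typical p q G} ⊆
      {G | √(n.choose 3 * q * (3 * n * p + 1) * Real.log n) ≤
        |cliqueCount 3 G - n.choose 3 * q|} ∪
      {G | n.choose 2 * p / 2 ≤ |cliqueCount 2 G - n.choose 2 * p|} := by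
    intro G hG
    by_contra hcon
    simp only [Set.mem_union, Set.mem_ofPred_eq, not_or, not_le] at hcon
    exact hG hcon
  refine (measureReal_mono hsub).trans ((measureReal_union_le _ _).trans (add_le_add ?_ ?_))
  · refine (measureReal_triangleCount h hp.le hq.le (Real.sqrt_pos.2 (by positivity))).trans
      (le_of_eq ?_)
    rw [Real.sq_sqrt (by positivity)]
    field_simp
  · refine (measureReal_edgeCount h (by positivity)).trans (le_of_eq ?_)
    field_simp
    norm_num

/-- On typical graphs the estimated deviation is of the order of the deviation bound. -/
theorem Typical.sigmaHat_bounds {G : SimpleGraph (Fin n)} (hG : Typical p q G) (hp : 0 < p)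
    (hq : 0 < q) (hn : 3 ≤ n) (hμ : 4 * (3 * n * p + 1) * Real.log n ≤ n.choose 3 * q) :
    √(n.choose 3 * q * (3 * n * p + 1) * Real.log n) / 2 ≤ n.choose 3 * sigmaHat G ∧
      n.choose 3 * sigmaHat G ≤ 4 * √(n.choose 3 * q * (3 * n * p + 1) * Real.log n) := by
  obtain ⟨hT, hE⟩ := hG
  have h2 : (0 : ℝ) < n.choose 2 := by exact_mod_cast Nat.choose_pos (by omega)
  have h3 : (0 : ℝ) < n.choose 3 := by exact_mod_cast Nat.choose_pos hn
  have hlog : 0 < Real.log n := Real.log_pos (by exact_mod_cast (by omega : 1 < n))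
  have hn0 : (0 : ℝ) < n := by exact_mod_cast (by omega : 0 < n)
  set μ : ℝ := n.choose 3 * q with hμdef
  set w : ℝ := 3 * n * p + 1 with hwdef
  have hμ0 : 0 < μ := by positivity
  have hw : 0 < w := by positivity
  have hdev : √(μ * w * Real.log n) ≤ μ / 2 := by
    rw [Real.sqrt_le_left (by positivity)]
    nlinarith
  have hN := abs_lt.1 (hT.trans_le hdev)
  have hM := abs_lt.1 hE
  set N := cliqueCount 3 G with hNdef
  have hd : edgeDensity G = cliqueCount 2 G / n.choose 2 := edgeDensity_eq G
  have hd1 : p / 2 ≤ edgeDensity G := by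
    rw [hd, le_div_iff₀ h2]
    linarith
  have hd2 : edgeDensity G ≤ 2 * p := by
    rw [hd, div_le_iff₀ h2]
    nlinarith
  have hw1 : w / 2 ≤ 3 * n * edgeDensity G + 1 := by
    have := mul_le_mul_of_nonneg_left hd1 (by positivity : (0 : ℝ) ≤ 3 * n)
    rw [hwdef]
    linarith
  have hw2 : 3 * n * edgeDensity G + 1 ≤ 2 * w := by
    have := mul_le_mul_of_nonneg_left hd2 (by positivity : (0 : ℝ) ≤ 3 * n)
    rw [hwdef]
    linarith
  have hmul : ∀ y : ℝ, n.choose 3 * √(y / n.choose 3 / n.choose 3) = √y := by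
    intro y
    rw [div_div, Real.sqrt_div' _ (by positivity), Real.sqrt_mul_self h3.le]
    field_simp
  have hER : n.choose 3 * sigmaHatER G = 2 * √(N * Real.log n) := by
    rw [← hmul (N * Real.log n), sigmaHatER, fTriangle_eq, ← hNdef]
    ring_nf
  have hGeom : n.choose 3 * sigmaHatGeom G =
      √((3 * n * edgeDensity G + 1) * N * Real.log n) := by
    rw [← hmul ((3 * n * edgeDensity G + 1) * N * Real.log n), sigmaHatGeom, fTriangle_eq, ← hNdef]
    ring_nf
  have hmax : n.choose 3 * sigmaHat G = max (n.choose 3 * sigmaHatER G)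
      (n.choose 3 * sigmaHatGeom G) := mul_max_of_nonneg _ _ h3.le
  rw [hmax, hER, hGeom]
  have hN1 : μ / 2 ≤ N := by linarith
  have hN2 : N ≤ 2 * μ := by linarith
  constructor
  · refine le_max_of_le_right ?_
    rw [show √(μ * w * Real.log n) / 2 = √(w / 2 * (μ / 2) * Real.log n) by
      rw [show w / 2 * (μ / 2) * Real.log n = μ * w * Real.log n / 2 ^ 2 by ring,
        Real.sqrt_div' _ (by norm_num), Real.sqrt_sq (by norm_num)]]
    have : 0 ≤ 3 * n * edgeDensity G + 1 := by linarith
    gcongr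
  · have hsq : ∀ c y : ℝ, 0 ≤ c → c * √y = √(c ^ 2 * y) := fun c y hc => by
      rw [Real.sqrt_mul (sq_nonneg c), Real.sqrt_sq hc]
    have h4 := hsq 4 (μ * w * Real.log n) (by norm_num)
    have h2' := hsq 2 (N * Real.log n) (by norm_num)
    have hw3 : 1 ≤ w := by
      have : 0 ≤ 3 * n * p := by positivity
      linarith
    refine max_le ?_ ?_
    · rw [h4, h2']
      refine Real.sqrt_le_sqrt ?_
      calc 2 ^ 2 * (N * Real.log n) ≤ 2 ^ 2 * (2 * μ * Real.log n) := by gcongr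
        _ ≤ 2 ^ 2 * (2 * (μ * w) * Real.log n) := by
          have : μ ≤ μ * w := le_mul_of_one_le_right hμ0.le hw3
          gcongr
        _ ≤ 4 ^ 2 * (μ * w * Real.log n) := by
          have : 0 ≤ μ * w * Real.log n := by positivity
          linarith
    · rw [h4]
      refine Real.sqrt_le_sqrt ?_
      calc (3 * n * edgeDensity G + 1) * N * Real.log n ≤ 2 * w * (2 * μ) * Real.log n := by
            have : 0 ≤ N := by linarith
            gcongr
        _ ≤ 4 ^ 2 * (μ * w * Real.log n) := by
          have : 0 ≤ μ * w * Real.log n := by positivity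
          linarith

theorem choose_mul_abs_fTriangle_sub (hn : 3 ≤ n) (G G' : SimpleGraph (Fin n)) :
    n.choose 3 * |fTriangle G - fTriangle G'| = |cliqueCount 3 G - cliqueCount 3 G'| := by
  have h3 : (0 : ℝ) < n.choose 3 := by exact_mod_cast Nat.choose_pos hn
  rw [fTriangle_eq, fTriangle_eq, ← sub_div, abs_div, abs_of_pos h3, mul_div_cancel₀ _ h3.ne']

/-- Two typical graphs for the same probabilities have triangle counts within twice the deviation
bound, which their estimated deviations reach. -/
theorem not_rejects_of_typical {G G' : SimpleGraph (Fin n)} (hG : Typical p q G)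
    (hG' : Typical p q G') (hp : 0 < p) (hq : 0 < q) (hn : 3 ≤ n)
    (hμ : 4 * (3 * n * p + 1) * Real.log n ≤ n.choose 3 * q) : ¬ Rejects G G' := by
  have h3 : (0 : ℝ) < n.choose 3 := by exact_mod_cast Nat.choose_pos hn
  have h1 := (hG.sigmaHat_bounds hp hq hn hμ).1
  have h2 := (hG'.sigmaHat_bounds hp hq hn hμ).1
  set s := √(n.choose 3 * q * (3 * n * p + 1) * Real.log n)
  have hdiff : |cliqueCount 3 G - cliqueCount 3 G'| ≤ s + s := by
    refine (abs_sub_le _ (n.choose 3 * q) _).trans (add_le_add hG.1.le ?_)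
    rw [abs_sub_comm]
    exact hG'.1.le
  have hs : 0 ≤ s := Real.sqrt_nonneg _
  rw [Rejects, not_lt, testStat]
  have hpos : 0 ≤ 2 * sigmaHat G + 2 * sigmaHat G' := by
    have hs1 : 0 ≤ sigmaHat G := (mul_nonneg_iff_of_pos_left h3).1 (by linarith)
    have hs2 : 0 ≤ sigmaHat G' := (mul_nonneg_iff_of_pos_left h3).1 (by linarith)
    linarith
  refine div_le_one_of_le₀ ?_ hpos
  rw [← mul_le_mul_iff_right₀ h3]
  rw [choose_mul_abs_fTriangle_sub hn]
  linarith

theorem rejects_comm (G G' : SimpleGraph (Fin n)) : Rejects G G' ↔ Rejects G' G := by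
  rw [Rejects, Rejects, testStat, testStat, abs_sub_comm, add_comm (2 * sigmaHat G)]

/-- If the triangle probabilities differ by a factor of `2` and the mean counts dominate the
deviations, then the difference of the counts exceeds the estimated deviations. -/
theorem rejects_of_typical {q' : ℝ} {G G' : SimpleGraph (Fin n)} (hG : Typical p q G)
    (hG' : Typical p q' G') (hp : 0 < p) (hq : 0 < q) (hqq : 2 * q ≤ q') (hn : 3 ≤ n)
    (hμ : 1600 * (3 * n * p + 1) * Real.log n ≤ n.choose 3 * q) : Rejects G G' := by
  have h3 : (0 : ℝ) < n.choose 3 := by exact_mod_cast Nat.choose_pos hn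
  have hlog : 0 < Real.log n := Real.log_pos (by exact_mod_cast (by omega : 1 < n))
  have hn0 : (0 : ℝ) < n := by exact_mod_cast (by omega : 0 < n)
  have hq' : 0 < q' := by linarith
  have hw : 0 < (3 * n * p + 1) * Real.log n := by positivity
  have hμμ : 2 * (n.choose 3 * q) ≤ n.choose 3 * q' := by
    have := mul_le_mul_of_nonneg_left hqq h3.le
    linarith
  obtain ⟨l1, u1⟩ := hG.sigmaHat_bounds hp hq hn (by linarith)
  obtain ⟨l2, u2⟩ := hG'.sigmaHat_bounds hp hq' hn (by linarith)
  have d1 := abs_lt.1 hG.1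
  have d2 := abs_lt.1 hG'.1
  set μ : ℝ := n.choose 3 * q
  set μ' : ℝ := n.choose 3 * q'
  have hμ0 : 0 < μ := by positivity
  have hs0 : 0 < √(μ * (3 * n * p + 1) * Real.log n) := Real.sqrt_pos.2 (by positivity)
  have hs1 : √(μ * (3 * n * p + 1) * Real.log n) ≤ √(μ' * (3 * n * p + 1) * Real.log n) := by
    gcongr
    linarith
  have hs2 : √(μ' * (3 * n * p + 1) * Real.log n) ≤ μ' / 40 := by
    rw [Real.sqrt_le_left (by linarith)]
    nlinarith
  set s := √(μ * (3 * n * p + 1) * Real.log n)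
  set s' := √(μ' * (3 * n * p + 1) * Real.log n)
  have hpos : 0 < n.choose 3 * (2 * sigmaHat G + 2 * sigmaHat G') := by linarith
  have hpos' : 0 < 2 * sigmaHat G + 2 * sigmaHat G' := (mul_pos_iff_of_pos_left h3).1 hpos
  rw [Rejects, testStat, lt_div_iff₀ hpos', one_mul, ← mul_lt_mul_iff_right₀ h3]
  rw [choose_mul_abs_fTriangle_sub hn, abs_sub_comm]
  refine lt_of_lt_of_le ?_ (le_abs_self _)
  linarith

end Typical

/-! ### Error probabilities -/

/-- The union bound for two independent observations. -/
theorem prod_le_add {Ω : Type*} [MeasurableSpace Ω] {Q Q' : Measure Ω} [IsProbabilityMeasure Q]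
    [IsProbabilityMeasure Q'] {A B : Set Ω} {S : Set (Ω × Ω)}
    (h : ∀ z ∈ S, z.1 ∈ A ∨ z.2 ∈ B) : (Q.prod Q') S ≤ Q A + Q' B := by
  have hsub : S ⊆ A ×ˢ Set.univ ∪ Set.univ ×ˢ B := by
    intro z hz
    rcases h z hz with h | h
    · exact Or.inl ⟨h, trivial⟩
    · exact Or.inr ⟨trivial, h⟩
  refine (measure_mono hsub).trans ((measure_union_le _ _).trans ?_)
  rw [Measure.prod_prod, Measure.prod_prod, measure_univ, measure_univ, mul_one, one_mul]

section Errors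

variable {n : ℕ} {p q q' : ℝ} {Q Q' : Measure (SimpleGraph (Fin n))} [IsProbabilityMeasure Q]
  [IsProbabilityMeasure Q']

theorem measure_not_typical_le (h : CliqueMoments Q p q) (hp : Real.log n / n ≤ p) (hq : 0 < q)
    (hn : 3 ≤ n) : Q {G | ¬ Typical p q G} ≤ ENNReal.ofReal (5 / Real.log n) := by
  have hlog : 0 < Real.log n := Real.log_pos (by exact_mod_cast (by omega : 1 < n))
  have hn3 : (3 : ℝ) ≤ n := by exact_mod_cast hn
  have hp0 : 0 < p := lt_of_lt_of_le (by positivity) hp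
  rw [← ENNReal.ofReal_toReal (measure_ne_top Q _)]
  refine ENNReal.ofReal_le_ofReal ((measureReal_not_typical_le h hp0 hq hn).trans ?_)
  have h2 : Real.log n ≤ n.choose 2 * p := by
    rw [Nat.cast_choose_two]
    rw [div_le_iff₀ (by linarith)] at hp
    nlinarith
  have h3 : 4 / (n.choose 2 * p) ≤ 4 / Real.log n := by gcongr
  calc _ ≤ 1 / Real.log n + 4 / Real.log n := by gcongr
    _ = _ := by ring

theorem typeIError_le (h : CliqueMoments Q p q) (hp : Real.log n / n ≤ p) (hq : 0 < q)
    (hn : 3 ≤ n) (hμ : 4 * (3 * n * p + 1) * Real.log n ≤ n.choose 3 * q) :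
    typeIError Q ≤ 2 * ENNReal.ofReal (5 / Real.log n) := by
  have hlog : 0 < Real.log n := Real.log_pos (by exact_mod_cast (by omega : 1 < n))
  have hn3 : (3 : ℝ) ≤ n := by exact_mod_cast hn
  have hp0 : 0 < p := lt_of_lt_of_le (by positivity) hp
  rw [two_mul]
  refine (prod_le_add (A := {G | ¬ Typical p q G}) (B := {G | ¬ Typical p q G}) ?_).trans
    (add_le_add (measure_not_typical_le h hp hq hn) (measure_not_typical_le h hp hq hn))
  intro z hz
  by_contra! hcon
  simp only [Set.mem_ofPred_eq, not_not] at hcon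
  exact not_rejects_of_typical hcon.1 hcon.2 hp0 hq hn hμ hz

theorem typeIIError_le (h : CliqueMoments Q p q) (h' : CliqueMoments Q' p q')
    (hp : Real.log n / n ≤ p) (hq : 0 < q) (hqq : 2 * q ≤ q') (hn : 3 ≤ n)
    (hμ : 1600 * (3 * n * p + 1) * Real.log n ≤ n.choose 3 * q) :
    typeIIError Q Q' ≤ 2 * ENNReal.ofReal (5 / Real.log n) ∧
      typeIIError Q' Q ≤ 2 * ENNReal.ofReal (5 / Real.log n) := by
  have hlog : 0 < Real.log n := Real.log_pos (by exact_mod_cast (by omega : 1 < n))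
  have hn3 : (3 : ℝ) ≤ n := by exact_mod_cast hn
  have hp0 : 0 < p := lt_of_lt_of_le (by positivity) hp
  have hq' : 0 < q' := by linarith
  have b := measure_not_typical_le h hp hq hn
  have b' := measure_not_typical_le h' hp hq' hn
  rw [two_mul]
  constructor
  · refine (prod_le_add (A := {G | ¬ Typical p q G}) (B := {G | ¬ Typical p q' G}) ?_).trans
      (add_le_add b b')
    intro z hz
    by_contra! hcon
    simp only [Set.mem_ofPred_eq, not_not] at hcon
    exact hz (rejects_of_typical hcon.1 hcon.2 hp0 hq hqq hn hμ)
  · refine (prod_le_add (A := {G | ¬ Typical p q' G}) (B := {G | ¬ Typical p q G}) ?_).trans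
      (add_le_add b' b)
    intro z hz
    by_contra! hcon
    simp only [Set.mem_ofPred_eq, not_not] at hcon
    exact hz ((rejects_comm _ _).1 (rejects_of_typical hcon.2 hcon.1 hp0 hq hqq hn hμ))

end Errors

/-- At density at least `log n / n`, the mean triangle count eventually dominates the
variance proxy. -/
theorem mean_dominates {n : ℕ} {p : ℝ} (hn : 6 ≤ n) (hlog : 172800 ≤ Real.log n)
    (hp : Real.log n / n ≤ p) :
    1600 * (3 * n * p + 1) * Real.log n ≤ n.choose 3 * p ^ 3 := by
  have hn6 : (6 : ℝ) ≤ n := by exact_mod_cast hn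
  have hx : Real.log n ≤ n * p := by
    rw [div_le_iff₀ (by linarith)] at hp
    linarith
  have hp0 : 0 < p := lt_of_lt_of_le (by positivity) hp
  have hc : (n : ℝ) ^ 3 / 27 ≤ n.choose 3 := by
    refine le_trans ?_ (Nat.pow_le_choose 3 n)
    have hcast : ((n + 1 - 3 : ℕ) : ℝ) = n - 2 := by
      rw [Nat.cast_sub (by omega)]
      push_cast
      ring
    rw [hcast, show ((Nat.factorial 3 : ℕ) : ℝ) = 6 by norm_num [Nat.factorial]]
    have : (2 / 3 * n : ℝ) ^ 3 ≤ (n - 2) ^ 3 := by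
      gcongr
      linarith
    have hn3 : (0 : ℝ) ≤ n ^ 3 := by positivity
    rw [mul_pow] at this
    linarith
  set x := n * p with hxdef
  have hx0 : 172800 ≤ x := hlog.trans hx
  have h1 : 1600 * (3 * n * p + 1) * Real.log n ≤ 1600 * (4 * x) * x := by
    have e : 3 * n * p + 1 ≤ 4 * x := by rw [hxdef] at hx0 ⊢; linarith
    have : 0 ≤ 3 * n * p + 1 := by positivity
    gcongr
  have h2 : x ^ 3 / 27 ≤ n.choose 3 * p ^ 3 := by
    calc x ^ 3 / 27 = n ^ 3 / 27 * p ^ 3 := by rw [hxdef]; ring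
      _ ≤ _ := by gcongr
  -- `172800 = 27 * 4 * 1600`
  have h3 : 1600 * (4 * x) * x ≤ x ^ 3 / 27 := by nlinarith [sq_nonneg x]
  linarith

theorem tendsto_iSup_ge_of_tendsto {g : ℕ → ℝ≥0∞} (h : Tendsto g atTop (𝓝 0)) :
    Tendsto (fun n => ⨆ m ≥ n, g m) atTop (𝓝 0) := by
  rw [ENNReal.tendsto_atTop_zero] at h ⊢
  intro ε hε
  obtain ⟨N, hN⟩ := h ε hε
  exact ⟨N, fun n hn => iSup₂_le fun m hm => hN m (hn.trans hm)⟩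

end TriangleTest

end

theorem corollary3 (p : ℕ → unitInterval) (r : ℕ → ℕ) (τ : ℕ → ℝ)
    (hp : ∀ n : ℕ, 1 ≤ n → Real.log n / n ≤ (p n : ℝ) ∧ (p n : ℝ) ≤ 1 / √(n : ℝ))
    (hτ : ∀ n : ℕ, 1 ≤ n → IsThreshold (r n) (p n) (τ n))
    (hr : (fun n : ℕ => (r n : ℝ)) =o[atTop] fun n : ℕ => (Real.log (1 / (p n : ℝ))) ^ 3) :
    UniformlyConsistent fun n : ℕ => modelLaw n (p n) (r n) (τ n) := by
  refine TriangleTest.tendsto_iSup_ge_of_tendsto ?_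
  have hlogtop : Tendsto (fun n : ℕ => Real.log n) atTop atTop :=
    Real.tendsto_log_atTop.comp tendsto_natCast_atTop_atTop
  have hlim : Tendsto (fun n : ℕ => 4 * ENNReal.ofReal (5 / Real.log n)) atTop (𝓝 0) := by
    have h1 : Tendsto (fun n : ℕ => 5 / Real.log n) atTop (𝓝 0) := hlogtop.const_div_atTop 5
    have h2 := ENNReal.Tendsto.const_mul (a := 4) (ENNReal.tendsto_ofReal h1) (Or.inr (by simp))
    simpa using h2
  refine tendsto_of_tendsto_of_tendsto_of_le_of_le' tendsto_const_nhds hlim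
    (Eventually.of_forall fun _ => zero_le) ?_
  -- The dimension is at most `(log (1 / p) / 127) ^ 3` for large `n`.
  have hr' := hr.bound (c := 1 / 127 ^ 3) (by norm_num)
  filter_upwards [eventually_ge_atTop 6, hlogtop.eventually_ge_atTop 172800, hr'] with n hn hlog hrn
  obtain ⟨hp1, hp2⟩ := hp n (by omega)
  have hth := hτ n (by omega)
  have hn6 : (6 : ℝ) ≤ n := by exact_mod_cast hn
  have hp0 : 0 < (p n : ℝ) := lt_of_lt_of_le (by positivity) hp1
  have hL : Real.log n / 2 ≤ Real.log (1 / (p n : ℝ)) := by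
    have h1 : √(n : ℝ) ≤ 1 / (p n : ℝ) := by
      rw [le_div_iff₀ hp0]
      rwa [le_div_iff₀ (Real.sqrt_pos.2 (by linarith)), mul_comm] at hp2
    have h2 := Real.log_le_log (Real.sqrt_pos.2 (by linarith)) h1
    rwa [Real.log_sqrt (by linarith)] at h2
  have hdim : r n * (127 : ℝ) ^ 3 ≤ Real.log (1 / (p n : ℝ)) ^ 3 := by
    have h0 : 0 ≤ Real.log (1 / (p n : ℝ)) := by linarith
    rw [Real.norm_of_nonneg (by positivity), Real.norm_of_nonneg (by positivity)] at hrn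
    linarith
  have hsig := TriangleTest.two_mul_cube_le_triangleProb hth hp0 (by linarith) hdim
  have hhalf : (p n : ℝ) < 1 / 2 := by
    have h1 := Real.log_le_sub_one_of_pos (one_div_pos.2 hp0)
    have h2 : 2 < 1 / (p n : ℝ) := by linarith
    rw [lt_div_iff₀ hp0] at h2
    linarith
  obtain ⟨hr2, hcap⟩ := TriangleTest.two_le_and_capMass_eq hth hp0 hhalf
  have : NeZero (r n) := ⟨by omega⟩
  have hER := TriangleTest.cliqueMoments_binomialRandom (n := n) (p n)
  have hGe := TriangleTest.cliqueMoments_geomLaw (n := n) hp0.le hcap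
  have hfin : TriangleTest.triangleProb (r n) (τ n) ≠ ∞ := by
    have he : ‖EuclideanSpace.single (0 : Fin (r n)) (1 : ℝ)‖ = 1 := by simp
    have := TriangleTest.nontrivial_of_norm_eq_one he
    rw [← TriangleTest.triangleMass_eq_triangleProb he]
    exact measure_ne_top _ _
  have hqq : 2 * (p n : ℝ) ^ 3 ≤ (TriangleTest.triangleProb (r n) (τ n)).toReal :=
    (ENNReal.ofReal_le_iff_le_toReal hfin).1 hsig
  have hq : 0 < (p n : ℝ) ^ 3 := by positivity
  have hμ := TriangleTest.mean_dominates hn hlog hp1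
  have hw : 0 ≤ (3 * n * (p n : ℝ) + 1) * Real.log n := by positivity
  have hμ' : (n.choose 3 : ℝ) * (p n : ℝ) ^ 3 ≤
      n.choose 3 * (TriangleTest.triangleProb (r n) (τ n)).toReal := by
    gcongr
    linarith
  have I1 := TriangleTest.typeIError_le hER hp1 hq (by omega) (by linarith)
  have I2 := TriangleTest.typeIError_le hGe hp1 (by linarith) (by omega) (by linarith)
  obtain ⟨II1, II2⟩ := TriangleTest.typeIIError_le hER hGe hp1 hq hqq (by omega) hμ
  have h4 : (4 : ℝ≥0∞) * ENNReal.ofReal (5 / Real.log n) =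
      2 * ENNReal.ofReal (5 / Real.log n) + 2 * ENNReal.ofReal (5 / Real.log n) := by ring
  rw [h4]
  refine iSup_le fun i => ?_
  cases i with
  | ER =>
    refine add_le_add I1 (iSup₂_le fun j hj => ?_)
    cases j with
    | ER => exact absurd rfl hj
    | Geom => exact II1
  | Geom =>
    refine add_le_add I2 (iSup₂_le fun j hj => ?_)
    cases j with
    | ER => exact II2
    | Geom => exact absurd rfl hj
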